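/- Let $q>2$ be a prime power, let $\mathbb C_\infty$ be the completion of an algebraic closure of $\mathbb F_q((1/\theta))$, and let $\mathrm{ord}$ be its valuation with $\mathrm{ord}\,\theta=-1$. Let $\mathbb C_\infty[T,\tau]$ be the ring with relations $Ta=aT$, $T\tau=\tau T$, $\tau a=a^q\tau$ ($a\in\mathbb C_\infty$), and let $\mathbb C_\infty\{\tau\}$ be its subring of skew polynomials in $\tau$. A t-motive is a left $\mathbb C_\infty[T,\tau]$-module $M$ that is free and finitely generated both over $\mathbb C_\infty[T]$ (its rank there is the rank $r$ of $M$) and over $\mathbb C_\infty\{\tau\}$ (its rank there is the dimension of $M$), and such that $(T-\theta)^{m}M\subseteq\tau M$ for some $m$. Let $\mathbb C_\infty\{T\}$ be the ring of power series $\sum_i c_iT^i$ over $\mathbb C_\infty$ with $c_i\to0$, with $\tau(\sum_i c_iT^i)=\sum_i c_i^qT^i$. Put $H^1(M)=(M\otimes_{\mathbb C_\infty[T]}\mathbb C_\infty\{T\})^{\tau}$, where $\tau(m\otimes s)=\tau m\otimes\tau(s)$; this is an $\mathbb F_q[T]$-module, and $h^1(M)$ denotes its rank. $M$ is called uniformizable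 if $h^1(M)=r$. For $A,N\in M_2(\mathbb C_\infty)$ let $M(A,N)$ be the free left $\mathbb C_\infty\{\tau\}$-module with basis $e_*=(e_1,e_2)^t$ on which $T$ acts by $$Te_*=(\theta I_2+N)e_*+A\tau e_*+\tau^2e_*.$$ **Theorem 5.1.** Let $a_{21},a_{12}\in\mathbb C_\infty$ satisfy $\mathrm{ord}\,a_{21}=-\frac{q^2}{q-1}$ and $$\frac{\theta^q}{a_{21}}+\frac{\theta^{q^2}}{a_{21}^{q^2}}-a_{12}^q=0,$$ and put $$A=\begin{pmatrix}0&a_{12}\\a_{21}&0\end{pmatrix},\qquad N_\varepsilon=\varepsilon\begin{pmatrix}0&1\\0&0\end{pmatrix}.$$ For $\varepsilon=0$ and for $\varepsilon=1$, $M(A,N_\varepsilon)$ is a t-motive of dimension $2$ and rank $4$. For $\varepsilon=0$ it is not uniformizable; more precisely, $H^1(M(A,N_0))=0$. For $\varepsilon=1$ it is uniformizable, i.e. $h^1(M(A,N_1))=4$. -/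

import Mathlib

open scoped Polynomial PowerSeries TensorProduct Topology NNReal

noncomputable section

/-! ### The field `ℂ_∞` -/

section Field

open Classical in
/-- `𝔽_q((1/θ))`: the completion of `𝔽_q(θ)` at the infinite place (`RatFunc.X` is `θ`). -/
def KInfty (Fq : Type*) [Field Fq] : Type _ := RatFunc.CompletionAtInfty Fq

variable (Fq : Type*) [Field Fq]

open Classical in
instance : Field (KInfty Fq) := inferInstanceAs (Field (RatFunc.CompletionAtInfty Fq))

open Classical in
instance : Algebra (RatFunc Fq) (KInfty Fq) :=
  inferInstanceAs (Algebra (RatFunc Fq) (RatFunc.CompletionAtInfty Fq))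

open Classical in
/-- The valuation at infinity, in multiplicative notation: `v θ = exp 1`. -/
instance : Valued (KInfty Fq) (WithZero (Multiplicative ℤ)) :=
  inferInstanceAs (Valued (RatFunc.CompletionAtInfty Fq) (WithZero (Multiplicative ℤ)))

open Classical in
instance : CompleteSpace (KInfty Fq) :=
  letI : UniformSpace (RatFunc Fq) := (RatFunc.inftyValued Fq).toUniformSpace
  inferInstanceAs (CompleteSpace (UniformSpace.Completion (RatFunc Fq)))

open Classical in
theorem KInfty.v_algebraMap (x : RatFunc Fq) :
    Valued.v (algebraMap (RatFunc Fq) (KInfty Fq) x) = RatFunc.inftyValuation Fq x :=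
  letI := RatFunc.inftyValued Fq
  Valued.extensionValuation_apply_coe x

theorem KInfty.v_theta :
    Valued.v (algebraMap (RatFunc Fq) (KInfty Fq) RatFunc.X) = WithZero.exp (1 : ℤ) := by
  classical
  rw [KInfty.v_algebraMap]
  exact RatFunc.inftyValuation.X Fq

variable [Fintype Fq]

theorem one_lt_card_nnreal : (1 : ℝ≥0) < (Fintype.card Fq : ℝ≥0) := by
  exact_mod_cast Fintype.one_lt_card

/-- The absolute value on `𝔽_q((1/θ))` is normalized by `|θ| = q`. -/
instance : Valuation.RankOne (Valued.v : Valuation (KInfty Fq) (WithZero (Multiplicative ℤ))) where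
  hom' := (WithZeroMulInt.toNNReal (one_lt_card_nnreal Fq).ne_bot).comp
    MonoidWithZeroHom.ValueGroup₀.embedding
  strictMono' := (WithZeroMulInt.toNNReal_strictMono (one_lt_card_nnreal Fq)).comp
    MonoidWithZeroHom.ValueGroup₀.embedding_strictMono
  exists_val_nontrivial := ⟨algebraMap (RatFunc Fq) (KInfty Fq) RatFunc.X, by
    rw [KInfty.v_theta]; simp⟩

instance : NontriviallyNormedField (KInfty Fq) :=
  Valued.toNontriviallyNormedField (KInfty Fq) (WithZero (Multiplicative ℤ))

instance : IsUltrametricDist (KInfty Fq) :=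
  IsUltrametricDist.isUltrametricDist_of_forall_norm_add_le_max_norm
    (Valued.v.norm_add_le (L := KInfty Fq))

/-- An algebraic closure of `𝔽_q((1/θ))`. -/
def KInftyBar : Type _ := AlgebraicClosure (KInfty Fq)

instance : Field (KInftyBar Fq) := inferInstanceAs (Field (AlgebraicClosure (KInfty Fq)))

instance : Algebra (KInfty Fq) (KInftyBar Fq) :=
  inferInstanceAs (Algebra (KInfty Fq) (AlgebraicClosure (KInfty Fq)))

instance : Algebra.IsAlgebraic (KInfty Fq) (KInftyBar Fq) :=
  inferInstanceAs (Algebra.IsAlgebraic (KInfty Fq) (AlgebraicClosure (KInfty Fq)))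

instance : IsAlgClosed (KInftyBar Fq) :=
  inferInstanceAs (IsAlgClosed (AlgebraicClosure (KInfty Fq)))

/-- The unique extension of the absolute value of `𝔽_q((1/θ))` to its algebraic closure. -/
instance : NormedField (KInftyBar Fq) := spectralNorm.normedField (KInfty Fq) (KInftyBar Fq)

instance : NormedAlgebra (KInfty Fq) (KInftyBar Fq) := spectralNorm.normedAlgebra _ _

/-- `ℂ_∞`: the completion of an algebraic closure of `𝔽_q((1/θ))`. -/
def CInfty : Type _ := UniformSpace.Completion (KInftyBar Fq)

instance : NormedField (CInfty Fq) :=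
  inferInstanceAs (NormedField (UniformSpace.Completion (KInftyBar Fq)))

instance : CompleteSpace (CInfty Fq) :=
  inferInstanceAs (CompleteSpace (UniformSpace.Completion (KInftyBar Fq)))

instance : NormedAlgebra (KInfty Fq) (CInfty Fq) :=
  inferInstanceAs (NormedAlgebra (KInfty Fq) (UniformSpace.Completion (KInftyBar Fq)))

instance : IsUltrametricDist (CInfty Fq) := IsUltrametricDist.of_normedAlgebra (KInfty Fq)

instance : Algebra Fq (CInfty Fq) :=
  ((algebraMap (KInfty Fq) (CInfty Fq)).comp
    ((algebraMap (RatFunc Fq) (KInfty Fq)).comp (algebraMap Fq (RatFunc Fq)))).toAlgebra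

/-- The element `θ` of `ℂ_∞`. -/
def theta : CInfty Fq :=
  algebraMap (KInfty Fq) (CInfty Fq) (algebraMap (RatFunc Fq) (KInfty Fq) RatFunc.X)

variable {Fq} in
open Classical in
/-- The valuation `ord` of `ℂ_∞`, normalized by `ord θ = -1`; `ord 0 = +∞`. -/
def ordInfty (x : CInfty Fq) : WithTop ℝ :=
  if x = 0 then ⊤ else ((-Real.logb (Fintype.card Fq) ‖x‖ : ℝ) : WithTop ℝ)

theorem KInfty.norm_def (x : KInfty Fq) :
    ‖x‖ = WithZeroMulInt.toNNReal (one_lt_card_nnreal Fq).ne_bot (Valued.v x) := by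
  rw [← Valuation.embedding_restrict]
  rfl

theorem norm_theta : ‖theta Fq‖ = Fintype.card Fq := by
  rw [theta, norm_algebraMap', KInfty.norm_def, KInfty.v_theta]
  rw [WithZeroMulInt.toNNReal_neg_apply _ WithZero.exp_ne_zero, NNReal.coe_zpow]
  exact zpow_one _

theorem ordInfty_theta : ordInfty (theta Fq) = ((-1 : ℝ) : WithTop ℝ) := by
  have h : (1 : ℝ) < ‖theta Fq‖ := by
    rw [norm_theta]; exact_mod_cast Fintype.one_lt_card
  have h0 : theta Fq ≠ 0 := by
    intro h0; rw [h0, norm_zero] at h; linarith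
  rw [ordInfty, if_neg h0, ← norm_theta, Real.logb_self_eq_one h]

/-- The Frobenius `x ↦ x ^ q` of `ℂ_∞`. -/
def frob : CInfty Fq →+* CInfty Fq := (FiniteField.frobeniusAlgHom Fq (CInfty Fq)).toRingHom

variable {Fq} in
theorem frob_apply (x : CInfty Fq) : frob Fq x = x ^ Fintype.card Fq := rfl

variable {Fq} in
theorem frob_algebraMap (a : Fq) : frob Fq (algebraMap Fq (CInfty Fq) a) = algebraMap Fq (CInfty Fq) a :=
  (FiniteField.frobeniusAlgHom Fq (CInfty Fq)).commutes a

theorem continuous_frob : Continuous (frob Fq) := continuous_pow (Fintype.card Fq)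

end Field

/-! ### `ℂ_∞[T]` and `ℂ_∞{T}` -/

section Series

variable (Fq : Type*) [Field Fq] [Fintype Fq]

/-- The action of `τ` on `ℂ_∞[T]`: the Frobenius on the coefficients, `T` being fixed. -/
def frobPoly : (CInfty Fq)[X] →+* (CInfty Fq)[X] := Polynomial.mapRingHom (frob Fq)

/-- `ℂ_∞{T}`: the power series whose coefficients tend to `0`. -/
def TateAlg : Subalgebra (CInfty Fq)[X] (CInfty Fq)⟦X⟧ where
  carrier := {f | Filter.Tendsto (fun i : ℕ => PowerSeries.coeff i f) Filter.atTop (𝓝 0)}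
  mul_mem' {f g} hf hg := by
    have key (h : (CInfty Fq)⟦X⟧) : PowerSeries.IsRestricted 1 h ↔
        Filter.Tendsto (fun i : ℕ => PowerSeries.coeff i h) Filter.atTop (𝓝 0) := by
      rw [PowerSeries.isRestricted_iff']
      simp only [one_pow, mul_one]
      exact tendsto_zero_iff_norm_tendsto_zero.symm
    exact (key _).1 (PowerSeries.isRestricted.mul 1 ((key f).2 hf) ((key g).2 hg))
  add_mem' {f g} hf hg := by
    have h : Filter.Tendsto (fun i : ℕ => PowerSeries.coeff i f + PowerSeries.coeff i g)
      Filter.atTop (𝓝 (0 + 0)) := Filter.Tendsto.add hf hg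
    simpa using h
  algebraMap_mem' p := by
    refine tendsto_const_nhds.congr' ?_
    filter_upwards [Filter.eventually_gt_atTop p.natDegree] with i hi
    rw [PowerSeries.algebraMap_apply', Algebra.algebraMap_self, PowerSeries.map_id]
    simp [Polynomial.coeff_eq_zero_of_natDegree_lt hi]

/-- The action of `τ` on `ℂ_∞{T}`: the Frobenius on the coefficients. -/
def frobTate : TateAlg Fq →ₛₗ[frobPoly Fq] TateAlg Fq where
  toFun f := ⟨PowerSeries.map (frob Fq) f, by
    have h := ((continuous_frob Fq).tendsto 0).comp f.2
    rw [map_zero] at h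
    exact h⟩
  map_add' f g := Subtype.ext (by simp)
  map_smul' p f := Subtype.ext (by
    ext i
    simp [frobPoly, Algebra.smul_def, PowerSeries.algebraMap_apply'])

end Series

/-! ### t-motives

A left module over the Anderson ring `ℂ_∞[T, τ]` is a `ℂ_∞[T]`-module `M` together with a map
`τ : M → M` that is semilinear with respect to the Frobenius on the coefficients. -/

section TMotive

variable {Fq : Type*} [Field Fq] [Fintype Fq]
variable {M : Type*} [AddCommGroup M] [Module (CInfty Fq)[X] M]

/-- `M` is free of rank `n` over `ℂ_∞{τ}`. Elements `e₁, …, eₙ` form a basis over `ℂ_∞{τ}` if and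
only if the elements `τ ^ j eᵢ` form a basis over `ℂ_∞`. -/
def HasDimension [Module (CInfty Fq) M] [IsScalarTower (CInfty Fq) (CInfty Fq)[X] M]
    (τ : M →ₛₗ[frobPoly Fq] M) (n : ℕ) : Prop :=
  ∃ b : Module.Basis (Fin n × ℕ) (CInfty Fq) M, ∀ i j, b (i, j + 1) = τ (b (i, j))

/-- The left `ℂ_∞[T, τ]`-module `M` is a t-motive: it is free and finitely generated both over
`ℂ_∞[T]` and over `ℂ_∞{τ}`, and some power of `T - θ` annihilates `M / τ M`. -/
structure IsTMotive [Module (CInfty Fq) M] [IsScalarTower (CInfty Fq) (CInfty Fq)[X] M]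
    (τ : M →ₛₗ[frobPoly Fq] M) : Prop where
  free : Module.Free (CInfty Fq)[X] M
  finite : Module.Finite (CInfty Fq)[X] M
  free_tau : ∃ n, HasDimension τ n
  nilpotent : ∃ m : ℕ, ∀ x : M,
    (Polynomial.X - Polynomial.C (theta Fq)) ^ m • x ∈ Set.range τ

/-- The scalars `𝔽_q[T] ⊆ ℂ_∞[T]` acting on `M{T} = M ⊗ ℂ_∞{T}`. -/
instance : Module Fq[X] (M ⊗[(CInfty Fq)[X]] TateAlg Fq) :=
  Module.compHom _ (Polynomial.mapRingHom (algebraMap Fq (CInfty Fq)))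

/-- `τ` on `M{T} = M ⊗ ℂ_∞{T}`: `τ (m ⊗ s) = τ m ⊗ τ s`. -/
def tauTensor (τ : M →ₛₗ[frobPoly Fq] M) :
    M ⊗[(CInfty Fq)[X]] TateAlg Fq →ₛₗ[frobPoly Fq] M ⊗[(CInfty Fq)[X]] TateAlg Fq :=
  TensorProduct.map τ (frobTate Fq)

/-- `H¹(M) = M{T}^τ`, a module over `𝔽_q[T]`. -/
def HOne (τ : M →ₛₗ[frobPoly Fq] M) : Submodule Fq[X] (M ⊗[(CInfty Fq)[X]] TateAlg Fq) where
  carrier := {x | tauTensor τ x = x}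
  zero_mem' := map_zero (tauTensor τ)
  add_mem' {x y} hx hy := by
    change tauTensor τ (x + y) = x + y
    rw [map_add, Set.mem_ofPred.1 hx, Set.mem_ofPred.1 hy]
  smul_mem' a x hx := by
    have h : frobPoly Fq (a.map (algebraMap Fq (CInfty Fq))) = a.map (algebraMap Fq (CInfty Fq)) := by
      ext i
      simp [frobPoly, frob_algebraMap]
    change tauTensor τ (a.map (algebraMap Fq (CInfty Fq)) • x) = a.map (algebraMap Fq (CInfty Fq)) • x
    rw [map_smulₛₗ, h, Set.mem_ofPred.1 hx]

/-- `h¹(M)`: the rank of `H¹(M)` over `𝔽_q[T]`. -/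
def hOne (τ : M →ₛₗ[frobPoly Fq] M) : ℕ := Module.finrank Fq[X] (HOne τ)

/-- `M` is uniformizable: `h¹(M)` equals the rank of `M`, i.e. its rank over `ℂ_∞[T]`. -/
def IsUniformizable (τ : M →ₛₗ[frobPoly Fq] M) : Prop :=
  hOne τ = Module.finrank (CInfty Fq)[X] M

end TMotive

/-! ### The t-motive `M(A, N)` -/

section MotiveAN

variable {Fq : Type*} [Field Fq] [Fintype Fq] {n : ℕ}

/-- `τ` acts on `ℂ_∞` by `x ↦ x ^ q`. -/
instance : MulSemiringAction (Multiplicative ℕ) (CInfty Fq) :=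
  MulSemiringAction.compHom (CInfty Fq) (powersHom (CInfty Fq →+* CInfty Fq) (frob Fq))

/-- The matrix `θ Iₙ + N + A τ + τ²` over the ring `ℂ_∞{τ}` of skew polynomials in `τ`. -/
def matrixAN (A N : Matrix (Fin n) (Fin n) (CInfty Fq)) :
    Matrix (Fin n) (Fin n) (SkewPolynomial (CInfty Fq)) :=
  Matrix.of fun i j =>
    SkewPolynomial.monomial 0 ((theta Fq • (1 : Matrix (Fin n) (Fin n) (CInfty Fq)) + N) i j) +
    SkewPolynomial.monomial 1 (A i j) +
    SkewPolynomial.monomial 2 ((1 : Matrix (Fin n) (Fin n) (CInfty Fq)) i j)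

/-- The action of `T` on the free left `ℂ_∞{τ}`-module with basis `e₁, …, eₙ`: the
`ℂ_∞{τ}`-linear map with `T e_* = (θ Iₙ + N) e_* + A τ e_* + τ² e_*`. -/
def tAction (A N : Matrix (Fin n) (Fin n) (CInfty Fq)) :
    Module.End (CInfty Fq) (Fin n → SkewPolynomial (CInfty Fq)) :=
  (matrixAN A N).vecMulLinear.restrictScalars (CInfty Fq)

/-- `M(A, N)` as a `ℂ_∞[T]`-module. -/
abbrev MotiveAN (A N : Matrix (Fin n) (Fin n) (CInfty Fq)) : Type _ :=
  Module.AEval' (tAction A N)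

theorem X_mul_smul (a : CInfty Fq) (p : SkewPolynomial (CInfty Fq)) :
    SkewPolynomial.X * (a • p) = frob Fq a • (SkewPolynomial.X * p) := by
  have h : ∀ (c : CInfty Fq) (p : SkewPolynomial (CInfty Fq)), c • p = SkewPolynomial.C c * p := by
    intro c p
    have h1 : SkewPolynomial.C c = c • (1 : SkewPolynomial (CInfty Fq)) := by
      rw [← SkewPolynomial.C_1, ← SkewPolynomial.monomial_zero_left,
        ← SkewPolynomial.monomial_zero_left, SkewPolynomial.smul_monomial, smul_eq_mul, mul_one]
    rw [h1, smul_mul_assoc, one_mul]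
  rw [h, h, ← mul_assoc, ← mul_assoc]
  congr 1
  rw [← SkewPolynomial.monomial_one_one_eq_X, SkewPolynomial.monomial_mul_C,
    SkewPolynomial.C_mul_monomial, one_mul, mul_one]
  rfl

/-- The action of `τ` on `M(A, N)`: left multiplication by `τ`. -/
def tauAN (A N : Matrix (Fin n) (Fin n) (CInfty Fq)) :
    MotiveAN A N →ₛₗ[frobPoly Fq] MotiveAN A N where
  toFun x := Module.AEval'.of (tAction A N)
    ((SkewPolynomial.X : SkewPolynomial (CInfty Fq)) • (Module.AEval'.of (tAction A N)).symm x)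
  map_add' x y := by simp
  map_smul' p x := by
    obtain ⟨v, rfl⟩ := (Module.AEval'.of (tAction A N)).surjective x
    induction p using Polynomial.induction_on' generalizing v with
    | add p r hp hr => rw [add_smul, map_add, smul_add, map_add, hp, hr, map_add, add_smul]
    | monomial k a =>
      induction k generalizing v with
      | zero =>
        have hC (c : CInfty Fq) (w : Fin n → SkewPolynomial (CInfty Fq)) :
            Polynomial.C c • Module.AEval'.of (tAction A N) w =
              Module.AEval'.of (tAction A N) (c • w) := by
          rw [← Polynomial.algebraMap_eq, algebraMap_smul, map_smul]
        have hf : frobPoly Fq (Polynomial.C a) = Polynomial.C (frob Fq a) := Polynomial.map_C _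
        rw [Polynomial.monomial_zero_left, hf, hC, LinearEquiv.symm_apply_apply,
          LinearEquiv.symm_apply_apply, hC]
        congr 1
        ext1 i
        exact X_mul_smul a (v i)
      | succ k ih =>
        have hX (w : Fin n → SkewPolynomial (CInfty Fq)) :
            (SkewPolynomial.X : SkewPolynomial (CInfty Fq)) • tAction A N w =
              tAction A N ((SkewPolynomial.X : SkewPolynomial (CInfty Fq)) • w) :=
          ((matrixAN A N).vecMulLinear.map_smul _ w).symm
        have hf : frobPoly Fq Polynomial.X = Polynomial.X := Polynomial.map_X _
        rw [← Polynomial.monomial_mul_X, mul_smul, Module.AEval'.X_smul_of, ih, map_mul, mul_smul,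
          hf, LinearEquiv.symm_apply_apply, LinearEquiv.symm_apply_apply, hX,
          Module.AEval'.X_smul_of]

end MotiveAN

end

/-! The relation for Te_* expresses τ²e_* through e_* and τe_*, so e₁, e₂, τe₁, τe₂ is a basis over
`ℂ_∞[T]`. Let a, c, b, d be the coordinates of a τ-invariant vector and write f⁽ⁱ⁾ for the i-fold
Frobenius twist. Invariance means a = (T-θ)b⁽¹⁾, c = (T-θ)d⁽¹⁾ - εb⁽¹⁾, b = a⁽¹⁾ - a₂₁d⁽¹⁾, d = c⁽¹⁾
- a₁₂b⁽¹⁾. Eliminating a, c, d leaves αb⁽⁴⁾ - ηb⁽³⁾ + b = βTb⁽²⁾ + γTb⁽⁴⁾ - δT²b⁽⁴⁾, where δ =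
a₂₁/a₂₁^(q²), α = θ^(q³+q²)δ, η = ε^(q²)a₂₁, β = 1+δ, γ = (θ^(q³)+θ^(q²))δ. The relation between a₁₂
and a₂₁ says exactly that b⁽²⁾ has no term of degree 0 in T, and ord a₂₁ is chosen so that |α| = |β|
= 1 and |γ|, |δ| < 1. By `hOneEquiv`, H¹ is the module of solutions b whose coefficients tend to 0.

For ε = 0 the first nonzero coefficient is a root of αx^(q⁴) + x, hence of norm 1, and the term with
β forces norm 1 on all later ones: no nonzero solution converges (`restrictedSol_eq_bot`).

For ε = 1 the term a₂₁x^(q³), with a₂₁ large, makes small lifts available. Each of the q⁴ roots of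
αx^(q⁴) - a₂₁x^(q³) + x extends to a solution whose coefficients, chosen of minimal norm, tend to 0
(`exists_restrictedSol_coeff_zero_eq`); this gives rank at least 4. A dimension count gives rank at
most 4 (`card_le_of_linearIndependent_restrictedSol`). -/

noncomputable section

/-! ### Roots of minimal norm -/

section MinimalRoot

variable {K : Type*} [NormedField K] [IsUltrametricDist K]

/-- Up to sign the coefficient of degree k is an elementary symmetric function: each term omits k of
the roots, and each omitted root has norm at least ρ. -/
theorem norm_coeff_prod_X_sub_C_mul_pow_le {ρ : ℝ} (hρ : 0 ≤ ρ) (s : Multiset K)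
    (hs : ∀ x ∈ s, ρ ≤ ‖x‖) (k : ℕ) :
    ‖(s.map fun x => Polynomial.X - Polynomial.C x).prod.coeff k‖ * ρ ^ k ≤
      (s.map fun x => ‖x‖).prod := by
  induction s using Multiset.induction_on generalizing k with
  | empty =>
    rcases k with _ | k
    · simp
    · simp [Polynomial.coeff_one]
  | cons x s ih =>
    have hx := hs x (Multiset.mem_cons_self x s)
    have ih' := ih fun y hy => hs y (Multiset.mem_cons_of_mem hy)
    have hp : 0 ≤ (s.map fun x => ‖x‖).prod :=
      Multiset.prod_nonneg fun y hy => by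
        obtain ⟨z, -, rfl⟩ := Multiset.mem_map.1 hy
        exact norm_nonneg z
    simp only [Multiset.map_cons, Multiset.prod_cons, sub_mul]
    have key : ∀ g : K[X], ‖(Polynomial.X * g - Polynomial.C x * g).coeff k‖ * ρ ^ k ≤
        max (‖(Polynomial.X * g).coeff k‖ * ρ ^ k) (‖x‖ * (‖g.coeff k‖ * ρ ^ k)) := by
      intro g
      rw [Polynomial.coeff_sub, Polynomial.coeff_C_mul, ← mul_assoc, ← norm_mul,
        ← max_mul_of_nonneg _ _ (pow_nonneg hρ k)]
      refine mul_le_mul_of_nonneg_right ?_ (pow_nonneg hρ k)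
      simpa [sub_eq_add_neg] using IsUltrametricDist.norm_add_le_max
        (Polynomial.coeff (Polynomial.X * g) k) (-(x * g.coeff k))
    refine (key _).trans (max_le ?_ (mul_le_mul_of_nonneg_left (ih' k) (norm_nonneg x)))
    rcases k with _ | k
    · simpa using mul_nonneg (norm_nonneg x) hp
    · rw [Polynomial.coeff_X_mul, pow_succ, ← mul_assoc, mul_comm]
      exact mul_le_mul hx (ih' k) (by positivity) (norm_nonneg x)

/-- Over an algebraically closed ultrametric field, a root of minimal norm is bounded by
all the slopes of the Newton polygon. -/
theorem Polynomial.exists_root_norm_coeff_mul_pow_le [IsAlgClosed K] (f : K[X])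
    (hf : 0 < f.degree) :
    ∃ r, f.eval r = 0 ∧ ∀ k, ‖f.coeff k‖ * ‖r‖ ^ k ≤ ‖f.coeff 0‖ := by
  classical
  have hf0 : f ≠ 0 := by rintro rfl; simp at hf
  obtain ⟨r0, hr0⟩ := IsAlgClosed.exists_root f hf.ne'
  have hne : f.roots.toFinset.Nonempty := ⟨r0, by simpa [hf0] using hr0⟩
  obtain ⟨r, hr, hmin⟩ := f.roots.toFinset.exists_min_image (fun x => ‖x‖) hne
  rw [Multiset.mem_toFinset, Polynomial.mem_roots hf0] at hr
  refine ⟨r, hr, fun k => ?_⟩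
  have hfac := (IsAlgClosed.splits f).eq_prod_roots
  have hk := norm_coeff_prod_X_sub_C_mul_pow_le (norm_nonneg r) f.roots
    (fun x hx => hmin x (Multiset.mem_toFinset.2 hx)) k
  have h0 : ‖f.coeff 0‖ = ‖f.leadingCoeff‖ * (f.roots.map fun x => ‖x‖).prod := by
    conv_lhs => rw [hfac]
    rw [Polynomial.coeff_C_mul, norm_mul, Polynomial.coeff_zero_eq_eval_zero,
      Polynomial.eval_multiset_prod]
    congr 1
    rw [Multiset.map_map, ← normHom_apply, map_multiset_prod, Multiset.map_map]
    congr 2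
    ext x
    simp
  rw [h0]
  conv_lhs => rw [hfac]
  rw [Polynomial.coeff_C_mul, norm_mul, mul_assoc]
  exact mul_le_mul_of_nonneg_left hk (norm_nonneg _)

end MinimalRoot

/-! ### Algebraic closedness of `ℂ_∞` -/

section AlgClosed

open Polynomial in
/-- A complete ultrametric field with a dense algebraically closed subfield is algebraically
closed, in any characteristic. -/
theorem IsAlgClosed.of_denseRange_of_ultrametric {K L : Type*} [Field K]
    [NontriviallyNormedField L] [CompleteSpace L] [IsUltrametricDist L] [Algebra K L]
    (hi : DenseRange (algebraMap K L)) [IsAlgClosed K] : IsAlgClosed L := by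
  apply IsAlgClosed.of_exists_root
  intro f fmon firr
  have hdeg : f.natDegree ≠ 0 := (Irreducible.natDegree_pos firr).ne'
  let F := f.SplittingField
  let : NormedField F := spectralNorm.normedField L F
  let : NormedAlgebra L F := spectralNorm.normedAlgebra L F
  let a : F := rootOfSplits (SplittingField.splits f)
      (by simpa using degree_ne_of_natDegree_ne hdeg)
  have fa0 : f.aeval a = 0 := by
    rw [← eval_map_algebraMap]
    exact eval_rootOfSplits (Polynomial.SplittingField.splits f)
      (by simpa using degree_ne_of_natDegree_ne hdeg)
  -- `L` is complete, hence closed in the splitting field, so it suffices to approximate the root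
  -- `a` by elements of `L`.
  have hiso : Isometry (algebraMap L F) := algebraMap_isometry L F
  have hclosed : IsClosed (Set.range (algebraMap L F)) := hiso.isClosedEmbedding.isClosed_range
  have ha : a ∈ closure (Set.range (algebraMap L F)) := by
    rw [Metric.mem_closure_iff]
    intro δ hδ
    -- The threshold inverts the continuity-of-roots bound ((n+1)ε)^(1/n) max(|a|, 1), where n is
    -- the degree, so that the bound becomes δ.
    have hε : 0 < (δ / max ‖a‖ 1) ^ f.natDegree / (f.natDegree + 1) := by positivity
    obtain ⟨g, gmon, gdeg, gcoeff⟩ :=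
      exists_monic_and_natDegree_eq_and_norm_map_algebraMap_coeff_sub_lt hi fmon hε
    obtain ⟨b, hb, hab⟩ := exists_aroots_norm_sub_lt_of_norm_coeff_sub_lt
      hε fa0 fmon (gmon.map _) (gdeg ▸ (g.natDegree_map _)) gcoeff
      (by simpa [Polynomial.map_map] using (IsAlgClosed.splits g).map ((algebraMap L F).comp _))
    rw [← Real.rpow_natCast, mul_div_cancel₀ _ (by positivity),
      ← Real.rpow_mul (div_pos hδ (by positivity)).le,
      mul_inv_cancel₀ (by exact_mod_cast hdeg), Real.rpow_one,
      div_mul_cancel₀ _ (by positivity)] at hab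
    -- `g` already splits over `K`, so the nearby root lies in the image of `L`.
    rw [Polynomial.aroots_def, Splits.roots_map ((IsAlgClosed.splits g).map _),
      Multiset.mem_map] at hb
    obtain ⟨c, -, rfl⟩ := hb
    exact ⟨_, ⟨c, rfl⟩, by rwa [dist_eq_norm]⟩
  rw [hclosed.closure_eq] at ha
  obtain ⟨c, hc⟩ := ha
  refine ⟨c, (algebraMap L F).injective ?_⟩
  rwa [← Polynomial.aeval_algebraMap_apply_eq_algebraMap_eval, hc, map_zero]

end AlgClosed

section CInfty

variable (Fq : Type*) [Field Fq] [Fintype Fq]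

instance : NontriviallyNormedField (CInfty Fq) where
  non_trivial := ⟨theta Fq, by rw [norm_theta]; exact_mod_cast Fintype.one_lt_card⟩

/-- `ℂ_∞` is algebraically closed. -/
instance : IsAlgClosed (CInfty Fq) :=
  let : Algebra (KInftyBar Fq) (CInfty Fq) :=
    inferInstanceAs (Algebra (KInftyBar Fq) (UniformSpace.Completion (KInftyBar Fq)))
  IsAlgClosed.of_denseRange_of_ultrametric (K := KInftyBar Fq)
    (UniformSpace.Completion.denseRange_coe (α := KInftyBar Fq))

theorem frob_surjective : Function.Surjective (frob Fq) := fun x => by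
  obtain ⟨y, hy⟩ := IsAlgClosed.exists_pow_nat_eq x (Fintype.card_pos (α := Fq))
  exact ⟨y, hy⟩

end CInfty

/-! ### The recursion as an operator on power series -/

section FrobeniusSeries

variable (Fq K : Type*) [Field Fq] [Field K] [Algebra Fq K]

theorem PowerSeries.coeff_polynomial_smul (p : Fq[X]) (f : K⟦X⟧) (n : ℕ) :
    PowerSeries.coeff n (p • f) = ∑ x ∈ Finset.HasAntidiagonal.antidiagonal n,
      algebraMap Fq K (p.coeff x.1) * PowerSeries.coeff x.2 f := by
  rw [Algebra.smul_def, PowerSeries.algebraMap_apply', PowerSeries.coeff_mul]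
  simp

instance : IsScalarTower Fq Fq[X] K⟦X⟧ where
  smul_assoc c p f := by
    ext n
    rw [PowerSeries.coeff_polynomial_smul, PowerSeries.coeff_smul,
      PowerSeries.coeff_polynomial_smul, Finset.smul_sum]
    refine Finset.sum_congr rfl fun x _ => ?_
    rw [Polynomial.coeff_smul, smul_eq_mul, map_mul, mul_assoc, Algebra.smul_def]

variable [Fintype Fq]

/-- The Frobenius on the coefficients of power series, as an `𝔽_q[T]`-linear map. -/
def frobSeries : Module.End Fq[X] K⟦X⟧ where
  toFun := PowerSeries.map (FiniteField.frobeniusAlgHom Fq K).toRingHom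
  map_add' := map_add _
  map_smul' p f := by
    ext n
    simp only [RingHom.id_apply, PowerSeries.coeff_map, PowerSeries.coeff_polynomial_smul]
    simp [mul_pow, ← map_pow, FiniteField.pow_card]

variable {Fq K}

theorem coeff_frobSeries_pow (k n : ℕ) (f : K⟦X⟧) :
    PowerSeries.coeff n ((frobSeries Fq K ^ k) f) =
      PowerSeries.coeff n f ^ Fintype.card Fq ^ k := by
  induction k with
  | zero => simp
  | succ k ih =>
    rw [pow_succ', Module.End.mul_apply, frobSeries]
    simp only [LinearMap.coe_mk, AddHom.coe_mk, PowerSeries.coeff_map]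
    rw [← frobSeries, ih, pow_succ, pow_mul]
    rfl

theorem frobSeries_pow_mul (k : ℕ) (f g : K⟦X⟧) :
    (frobSeries Fq K ^ k) (f * g) = (frobSeries Fq K ^ k) f * (frobSeries Fq K ^ k) g := by
  induction k with
  | zero => simp
  | succ k ih =>
    rw [pow_succ', Module.End.mul_apply, ih]
    exact map_mul (PowerSeries.map (FiniteField.frobeniusAlgHom Fq K).toRingHom) _ _

theorem frobSeries_pow_X (k : ℕ) : (frobSeries Fq K ^ k) PowerSeries.X = PowerSeries.X := by
  ext n
  rw [coeff_frobSeries_pow, PowerSeries.coeff_X]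
  split_ifs <;> simp

theorem coeff_X_pow_mul_frobSeries_pow (m k n : ℕ) (f : K⟦X⟧) :
    PowerSeries.coeff n (PowerSeries.X ^ m * (frobSeries Fq K ^ k) f) =
      PowerSeries.coeff n (PowerSeries.X ^ m * f) ^ Fintype.card Fq ^ k := by
  rw [← coeff_frobSeries_pow, frobSeries_pow_mul]
  congr 2
  induction m with
  | zero => ext n; rw [coeff_frobSeries_pow, pow_zero, PowerSeries.coeff_one]; split_ifs <;> simp
  | succ m ih => rw [pow_succ, frobSeries_pow_mul, ← ih, frobSeries_pow_X]

variable (Fq)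

/-- The additive polynomial `α x ^ q ^ 4 - η x ^ q ^ 3 + x`. -/
def addPoly (α η : K) : K →ₗ[Fq] K :=
  α • ((FiniteField.frobeniusAlgHom Fq K).toLinearMap ^ 4) -
    η • ((FiniteField.frobeniusAlgHom Fq K).toLinearMap ^ 3) + LinearMap.id

theorem addPoly_apply (α η x : K) :
    addPoly Fq α η x = α * x ^ Fintype.card Fq ^ 4 - η * x ^ Fintype.card Fq ^ 3 + x := by
  have h (k : ℕ) : ((FiniteField.frobeniusAlgHom Fq K).toLinearMap ^ k) x =
      x ^ Fintype.card Fq ^ k := by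
    induction k with
    | zero => simp
    | succ k ih =>
      rw [pow_succ', Module.End.mul_apply, ih, pow_succ (Fintype.card Fq), pow_mul]
      rfl
  simp [addPoly, h]

/-- The operator whose kernel consists of the power series `f = ∑ fₙ Tⁿ` with
`addPoly α η fₙ = β fₙ₋₁ ^ q ^ 2 + γ fₙ₋₁ ^ q ^ 4 - δ fₙ₋₂ ^ q ^ 4`. -/
def recOp (α η β γ δ : K) : Module.End Fq[X] K⟦X⟧ :=
  LinearMap.mulLeft Fq[X] (PowerSeries.C α) * frobSeries Fq K ^ 4 -
    LinearMap.mulLeft Fq[X] (PowerSeries.C η) * frobSeries Fq K ^ 3 + 1 -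
    (LinearMap.mulLeft Fq[X] (PowerSeries.C β * PowerSeries.X ^ 1) * frobSeries Fq K ^ 2 +
      LinearMap.mulLeft Fq[X] (PowerSeries.C γ * PowerSeries.X ^ 1) * frobSeries Fq K ^ 4 -
      LinearMap.mulLeft Fq[X] (PowerSeries.C δ * PowerSeries.X ^ 2) * frobSeries Fq K ^ 4)

variable {Fq}

theorem recOp_apply (α η β γ δ : K) (f : K⟦X⟧) : recOp Fq α η β γ δ f =
    PowerSeries.C α * (frobSeries Fq K ^ 4) f - PowerSeries.C η * (frobSeries Fq K ^ 3) f + f -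
    (PowerSeries.C β * PowerSeries.X ^ 1 * (frobSeries Fq K ^ 2) f +
      PowerSeries.C γ * PowerSeries.X ^ 1 * (frobSeries Fq K ^ 4) f -
      PowerSeries.C δ * PowerSeries.X ^ 2 * (frobSeries Fq K ^ 4) f) := rfl

theorem recOp_eq_zero_iff (α η β γ δ : K) (f : K⟦X⟧) :
    recOp Fq α η β γ δ f = 0 ↔ ∀ n, addPoly Fq α η (PowerSeries.coeff n f) =
      β * PowerSeries.coeff n (PowerSeries.X ^ 1 * f) ^ Fintype.card Fq ^ 2 +
      γ * PowerSeries.coeff n (PowerSeries.X ^ 1 * f) ^ Fintype.card Fq ^ 4 -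
      δ * PowerSeries.coeff n (PowerSeries.X ^ 2 * f) ^ Fintype.card Fq ^ 4 := by
  rw [PowerSeries.ext_iff]
  refine forall_congr' fun n => ?_
  rw [recOp_apply, addPoly_apply]
  simp only [map_add, map_sub, mul_assoc, PowerSeries.coeff_C_mul, coeff_frobSeries_pow,
    coeff_X_pow_mul_frobSeries_pow, map_zero]
  exact sub_eq_zero

/-- The right-hand side of the recursion at n involves only the coefficients n-1 and n-2, so the
leading coefficient of a solution is a root of the additive polynomial. -/
theorem addPoly_coeff_eq_zero {α η β γ δ : K} {f : K⟦X⟧} (hf : recOp Fq α η β γ δ f = 0) {n : ℕ}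
    (hn : ∀ i < n, PowerSeries.coeff i f = 0) : addPoly Fq α η (PowerSeries.coeff n f) = 0 := by
  have hq : Fintype.card Fq ≠ 0 := Fintype.card_ne_zero
  have h (m : ℕ) (hm : m ≠ 0) : PowerSeries.coeff n (PowerSeries.X ^ m * f) = 0 := by
    rw [PowerSeries.coeff_X_pow_mul']
    split_ifs with h
    · exact hn _ (by omega)
    · rfl
  rw [(recOp_eq_zero_iff α η β γ δ f).1 hf n, h 1 one_ne_zero, h 2 two_ne_zero]
  simp [hq]

end FrobeniusSeries

/-! ### The kernel of the additive polynomial -/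

section AddPoly

variable {Fq K : Type*} [Field Fq] [Fintype Fq] [Field K]

/-- The polynomial `α X ^ q ^ 4 - η X ^ q ^ 3 + X - c`. -/
def addPolySub (Fq : Type*) [Fintype Fq] (α η c : K) : K[X] :=
  Polynomial.C α * Polynomial.X ^ Fintype.card Fq ^ 4 -
    Polynomial.C η * Polynomial.X ^ Fintype.card Fq ^ 3 + Polynomial.X - Polynomial.C c

theorem one_lt_card_pow (Fq : Type*) [Field Fq] [Fintype Fq] {k : ℕ} (hk : k ≠ 0) :
    1 < Fintype.card Fq ^ k := Nat.one_lt_pow hk Fintype.one_lt_card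

theorem coeff_one_addPolySub (α η c : K) : (addPolySub Fq α η c).coeff 1 = 1 := by
  have h3 := one_lt_card_pow Fq (k := 3) (by norm_num)
  have h4 := one_lt_card_pow Fq (k := 4) (by norm_num)
  simp [addPolySub, Polynomial.coeff_X_pow, h3.ne, h4.ne]

theorem coeff_zero_addPolySub (α η c : K) : (addPolySub Fq α η c).coeff 0 = -c := by
  have h (k : ℕ) : 0 ≠ Fintype.card Fq ^ k := (pow_ne_zero k Fintype.card_ne_zero).symm
  simp only [addPolySub, Polynomial.coeff_sub, Polynomial.coeff_add, Polynomial.coeff_C_mul,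
    Polynomial.coeff_X_pow, if_neg (h _), Polynomial.coeff_X_zero, Polynomial.coeff_C_zero]
  simp

theorem coeff_card_pow_three_addPolySub (α η c : K) :
    (addPolySub Fq α η c).coeff (Fintype.card Fq ^ 3) = -η := by
  have h3 := one_lt_card_pow Fq (k := 3) (by norm_num)
  have h34 : Fintype.card Fq ^ 3 < Fintype.card Fq ^ 4 :=
    Nat.pow_lt_pow_right Fintype.one_lt_card (by norm_num)
  simp [addPolySub, Polynomial.coeff_X_pow, Polynomial.coeff_X, Polynomial.coeff_C,
    h34.ne, h3.ne, -pow_eq_zero_iff]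

theorem natDegree_addPolySub {α : K} (hα : α ≠ 0) (η c : K) :
    (addPolySub Fq α η c).natDegree = Fintype.card Fq ^ 4 := by
  have h3 := one_lt_card_pow Fq (k := 3) (by norm_num)
  have h34 : Fintype.card Fq ^ 3 < Fintype.card Fq ^ 4 :=
    Nat.pow_lt_pow_right Fintype.one_lt_card (by norm_num)
  rw [addPolySub]
  compute_degree!
  · simpa [h34.ne', (h3.trans h34).ne] using hα
  all_goals omega

variable [Algebra Fq K]

theorem eval_addPolySub (α η c x : K) :
    (addPolySub Fq α η c).eval x = addPoly Fq α η x - c := by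
  simp [addPolySub, addPoly_apply]

theorem separable_addPolySub (α η c : K) : (addPolySub Fq α η c).Separable := by
  have h (k : ℕ) (hk : k ≠ 0) : ((Fintype.card Fq ^ k : ℕ) : K) = 0 := by
    have h0 : (Fintype.card Fq : K) = 0 := by
      rw [← map_natCast (algebraMap Fq K), FiniteField.cast_card_eq_zero, map_zero]
    rw [Nat.cast_pow, h0, zero_pow hk]
  have hd : (addPolySub Fq α η c).derivative = 1 := by
    have h3 := h 3 (by norm_num)
    have h4 := h 4 (by norm_num)
    rw [addPolySub]
    simp only [Polynomial.derivative_sub, Polynomial.derivative_add, Polynomial.derivative_mul,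
      Polynomial.derivative_C, Polynomial.derivative_X_pow, Polynomial.derivative_X, h3, h4]
    simp
  rw [Polynomial.Separable, hd]
  exact isCoprime_one_right

variable [IsAlgClosed K]

/-- The polynomial has derivative 1, hence is separable, and its degree is q⁴. -/
theorem card_ker_addPoly {α : K} (hα : α ≠ 0) (η : K) :
    Nat.card (LinearMap.ker (addPoly Fq α η)) = Fintype.card Fq ^ 4 := by
  classical
  have h0 : addPolySub Fq α η 0 ≠ 0 := fun h => by
    have := coeff_one_addPolySub (Fq := Fq) α η 0
    simp [h] at this
  have hset : (LinearMap.ker (addPoly Fq α η) : Set K) =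
      (addPolySub Fq α η 0).rootSet K := by
    ext x
    rw [Polynomial.mem_rootSet, SetLike.mem_coe, LinearMap.mem_ker, Polynomial.coe_aeval_eq_eval,
      eval_addPolySub, sub_zero]
    simp [h0]
  rw [← SetLike.coe_sort_coe, hset, Nat.card_eq_fintype_card,
    Polynomial.card_rootSet_eq_natDegree (separable_addPolySub α η 0)
      (by simpa using IsAlgClosed.splits _), natDegree_addPolySub hα]

instance finite_ker_addPoly {α : K} [NeZero α] (η : K) :
    Finite (LinearMap.ker (addPoly Fq α η)) :=
  Nat.finite_of_card_ne_zero (by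
    rw [card_ker_addPoly (NeZero.ne α)]
    exact pow_ne_zero _ Fintype.card_ne_zero)

theorem finrank_ker_addPoly {α : K} [NeZero α] (η : K) :
    Module.finrank Fq (LinearMap.ker (addPoly Fq α η)) = 4 := by
  have h := Module.natCard_eq_pow_finrank (K := Fq) (V := LinearMap.ker (addPoly Fq α η))
  rw [card_ker_addPoly (NeZero.ne α), Nat.card_eq_fintype_card] at h
  exact (Nat.pow_right_injective Fintype.one_lt_card h).symm

end AddPoly

/-! ### Solutions with coefficients tending to 0 -/

section RestrictedSolutions

/-- The constant terms of a relation over `Fq[X]` form a relation over `Fq`, so they vanish and the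
relation can be divided by T. Iterating, its coefficients are divisible by every power of T. -/
theorem linearIndependent_of_coeff_zero {Fq K ι : Type*} [Field Fq] [Field K] [Algebra Fq K]
    [Fintype ι] {f : ι → K⟦X⟧}
    (hf : LinearIndependent Fq fun j => PowerSeries.coeff 0 (f j)) :
    LinearIndependent Fq[X] f := by
  have key (N : ℕ) : ∀ p : ι → Fq[X], ∑ j, p j • f j = 0 → ∀ j, Polynomial.X ^ N ∣ p j := by
    induction N with
    | zero => simp
    | succ N ih =>
      intro p hp
      have h0 (j : ι) : Polynomial.X ∣ p j := by
        rw [Polynomial.X_dvd_iff]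
        refine Fintype.linearIndependent_iff.1 hf (fun j => (p j).coeff 0) ?_ j
        have := congrArg (PowerSeries.coeff 0) hp
        simpa only [map_sum, PowerSeries.coeff_polynomial_smul, map_zero,
          Finset.Nat.antidiagonal_zero, Finset.sum_singleton, Algebra.smul_def (A := K)] using this
      choose r hr using h0
      have hr0 : ∑ j, r j • f j = 0 := by
        have hX : algebraMap Fq[X] K⟦X⟧ Polynomial.X ≠ 0 := by
          simp [PowerSeries.algebraMap_apply', PowerSeries.X_ne_zero]
        refine (mul_eq_zero.1 (?_ : algebraMap Fq[X] K⟦X⟧ Polynomial.X * _ = 0)).resolve_left hX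
        rw [← Algebra.smul_def, Finset.smul_sum, ← hp]
        exact Finset.sum_congr rfl fun j _ => by rw [hr, mul_smul]
      intro j
      rw [hr, pow_succ']
      exact mul_dvd_mul_left _ (ih r hr0 j)
  rw [Fintype.linearIndependent_iff]
  intro p hp j
  ext n
  exact Polynomial.X_pow_dvd_iff.1 (key (n + 1) p hp j) n n.lt_succ_self

variable (Fq : Type*) {K : Type*} [Field Fq] [Fintype Fq] [NormedField K] [Algebra Fq K]

theorem norm_algebraMap_finite_le_one (c : Fq) : ‖algebraMap Fq K c‖ ≤ 1 := by
  by_contra! h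
  have h1 : ‖algebraMap Fq K c‖ ^ Fintype.card Fq = ‖algebraMap Fq K c‖ := by
    rw [← norm_pow, ← map_pow, FiniteField.pow_card]
  exact ((pow_lt_pow_right₀ h Fintype.one_lt_card).trans_eq h1).ne (pow_one _)

/-- The kernel is finite, so 0 is isolated in it. -/
theorem exists_pos_eq_zero_of_addPoly_eq_zero_of_norm_lt [IsUltrametricDist K]
    [IsAlgClosed K] (α : K) [NeZero α] (η : K) : ∃ ρ > 0, ∀ x : K, addPoly Fq α η x = 0 → ‖x‖ < ρ → x = 0 := by
  have hfin : (LinearMap.ker (addPoly Fq α η) \ {0} : Set K).Finite :=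
    (Set.finite_coe_iff.1 (finite_ker_addPoly (Fq := Fq) η)).subset Set.sdiff_subset
  obtain ⟨ρ, hρ, h⟩ := Metric.isOpen_iff.1 hfin.isClosed.isOpen_compl 0 (by simp)
  refine ⟨ρ, hρ, fun x hx hxρ => ?_⟩
  by_contra hx0
  exact h (mem_ball_zero_iff.2 hxρ) ⟨hx, hx0⟩

section FinrankBound

variable {Fq} {α η β γ δ : K} [IsAlgClosed K] [NeZero α]

/-- Filter `U` by order of vanishing. On solutions vanishing below j, the coefficient of index j
takes values in the 4-dimensional kernel of `addPoly`, so each of the k steps costs at most 4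
dimensions. -/
theorem finrank_le_of_recOp_eq_zero (k : ℕ) : ∀ (j : ℕ) (U : Submodule Fq K⟦X⟧)
    [FiniteDimensional Fq U], (∀ u ∈ U, recOp Fq α η β γ δ u = 0) →
    (∀ u ∈ U, ∀ i < j, PowerSeries.coeff i u = 0) →
    (∀ u ∈ U, (∀ i < j + k, PowerSeries.coeff i u = 0) → u = 0) →
    Module.finrank Fq U ≤ 4 * k := by
  induction k with
  | zero =>
    intro j U _ _ h1 h2
    have : U = ⊥ := (Submodule.eq_bot_iff U).2 fun u hu => h2 u hu (h1 u hu)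
    rw [this, finrank_bot]
  | succ k ih =>
    intro j U _ h0 h1 h2
    let c : U →ₗ[Fq] LinearMap.ker (addPoly Fq α η) :=
      LinearMap.codRestrict _
        (((PowerSeries.coeff (R := K) j).restrictScalars Fq).comp U.subtype) fun u =>
          addPoly_coeff_eq_zero (h0 u u.2) (h1 u u.2)
    have hc (u : U) (hu : u ∈ LinearMap.ker c) : PowerSeries.coeff j (u : K⟦X⟧) = 0 :=
      congrArg Subtype.val (LinearMap.mem_ker.1 hu)
    have hr : Module.finrank Fq (LinearMap.range c) ≤ 4 :=
      (Submodule.finrank_le _).trans_eq (finrank_ker_addPoly η)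
    have hk := ih (j + 1) ((LinearMap.ker c).map U.subtype)
      (by rintro _ ⟨u, -, rfl⟩; exact h0 u u.2)
      (by
        rintro _ ⟨u, hu, rfl⟩ i hi
        rcases Nat.lt_succ_iff_lt_or_eq.1 hi with hi | rfl
        · exact h1 u u.2 i hi
        · exact hc u hu)
      (by
        rintro _ ⟨u, hu, rfl⟩ h
        exact h2 u u.2 fun i hi => h i (by omega))
    rw [Submodule.finrank_map_subtype_eq] at hk
    have := LinearMap.finrank_range_add_finrank_ker c
    omega

end FinrankBound

variable [IsUltrametricDist K]

/-- The solutions of the recursion `recOp α η β γ δ f = 0` whose coefficients tend to `0`. -/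
def restrictedSol (α η β γ δ : K) : Submodule Fq[X] K⟦X⟧ where
  carrier := {f | recOp Fq α η β γ δ f = 0 ∧
    Filter.Tendsto (fun i => PowerSeries.coeff i f) Filter.atTop (𝓝 0)}
  zero_mem' := ⟨map_zero _, by simp⟩
  add_mem' {f g} hf hg := ⟨by rw [map_add, hf.1, hg.1, add_zero], by
    simpa using Filter.Tendsto.add hf.2 hg.2⟩
  smul_mem' p f hf := ⟨by rw [map_smul, hf.1, smul_zero], by
    have key (h : K⟦X⟧) : PowerSeries.IsRestricted 1 h ↔
        Filter.Tendsto (fun i : ℕ => PowerSeries.coeff i h) Filter.atTop (𝓝 0) := by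
      rw [PowerSeries.isRestricted_iff']
      simp only [one_pow, mul_one]
      exact tendsto_zero_iff_norm_tendsto_zero.symm
    rw [Algebra.smul_def]
    refine (key _).1 (PowerSeries.isRestricted.mul 1 ((key _).2 ?_) ((key f).2 hf.2))
    refine tendsto_const_nhds.congr' ?_
    filter_upwards [Filter.eventually_gt_atTop p.natDegree] with i hi
    rw [PowerSeries.algebraMap_apply', PowerSeries.coeff_map, Polynomial.coeff_coe,
      Polynomial.coeff_eq_zero_of_natDegree_lt hi, map_zero]⟩

variable {Fq} {α η β γ δ : K}

theorem mem_restrictedSol {f : K⟦X⟧} : f ∈ restrictedSol Fq α η β γ δ ↔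
    recOp Fq α η β γ δ f = 0 ∧
      Filter.Tendsto (fun i => PowerSeries.coeff i f) Filter.atTop (𝓝 0) := Iff.rfl

/-! ### The rank is at most 4 -/

section UpperBound

theorem norm_coeff_smul_le {p : Fq[X]} {d n : ℕ} (hp : p ∈ Polynomial.degreeLT Fq d)
    {f : K⟦X⟧} {ρ : ℝ} (hρ : 0 ≤ ρ) (hf : ∀ i, n ≤ i → ‖PowerSeries.coeff i f‖ ≤ ρ)
    {i : ℕ} (hi : n + d ≤ i) : ‖PowerSeries.coeff i (p • f)‖ ≤ ρ := by
  rw [PowerSeries.coeff_polynomial_smul]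
  refine IsUltrametricDist.norm_sum_le_of_forall_le_of_nonneg hρ fun x hx => ?_
  rw [Finset.HasAntidiagonal.mem_antidiagonal] at hx
  by_cases hxd : x.1 < d
  · rw [norm_mul]
    exact (mul_le_of_le_one_left (norm_nonneg _) (norm_algebraMap_finite_le_one Fq _)).trans
      (hf _ (by omega))
  · rw [Polynomial.coeff_eq_zero_of_degree_lt
      ((Polynomial.mem_degreeLT.1 hp).trans_le (by exact_mod_cast not_lt.1 hxd))]
    simpa using hρ

variable [IsAlgClosed K] [NeZero α]

/-- Combinations of the `v j` with coefficients of degree below d form an `Fq`-space of dimension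
md. Beyond index n+d their coefficients are smaller than any nonzero root of `addPoly`, so such a
combination vanishes once its first n+d coefficients do. Hence md ≤ 4(n+d) for every d, with n
independent of d. -/
theorem card_le_of_linearIndependent_restrictedSol {m : ℕ}
    {v : Fin m → K⟦X⟧} (hv : ∀ j, v j ∈ restrictedSol Fq α η β γ δ)
    (hli : LinearIndependent Fq[X] v) : m ≤ 4 := by
  obtain ⟨ρ, hρ, hmin⟩ := exists_pos_eq_zero_of_addPoly_eq_zero_of_norm_lt Fq α η
  have hn : ∃ n, ∀ j i, n ≤ i → ‖PowerSeries.coeff i (v j)‖ ≤ ρ / 2 := by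
    have : ∀ᶠ i in Filter.atTop, ∀ j, ‖PowerSeries.coeff i (v j)‖ ≤ ρ / 2 :=
      Filter.eventually_all.2 fun j =>
        (tendsto_zero_iff_norm_tendsto_zero.1 (hv j).2).eventually_le_const (by positivity)
    obtain ⟨n, hn⟩ := Filter.eventually_atTop.1 this
    exact ⟨n, fun j i hi => hn i hi j⟩
  obtain ⟨n, hn⟩ := hn
  have hbound (d : ℕ) : m * d ≤ 4 * (n + d) := by
    let φ : (Fin m → Polynomial.degreeLT Fq d) →ₗ[Fq] K⟦X⟧ :=
      ((Fintype.linearCombination Fq[X] v).restrictScalars Fq).comp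
        (LinearMap.pi fun j => (Polynomial.degreeLT Fq d).subtype.comp (LinearMap.proj j))
    have hφ (p) : φ p = ∑ j, (p j : Fq[X]) • v j := rfl
    have hinj : Function.Injective φ := by
      rw [← LinearMap.ker_eq_bot, LinearMap.ker_eq_bot']
      intro p hp
      ext1 j
      exact Subtype.ext (Fintype.linearIndependent_iff.1 hli _ hp j)
    let e := Polynomial.degreeLTEquiv Fq d
    have : FiniteDimensional Fq (Polynomial.degreeLT Fq d) := e.symm.finiteDimensional
    have hdim : Module.finrank Fq (LinearMap.range φ) = m * d := by
      rw [LinearMap.finrank_range_of_inj hinj, Module.finrank_pi_fintype]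
      simp [e.finrank_eq]
    rw [← hdim]
    have hsol (p) : recOp Fq α η β γ δ (φ p) = 0 := by
      rw [hφ, map_sum]
      refine Finset.sum_eq_zero fun j _ => ?_
      rw [map_smul, (mem_restrictedSol.1 (hv j)).1, smul_zero]
    refine finrank_le_of_recOp_eq_zero (α := α) (η := η) (β := β) (γ := γ) (δ := δ) (n + d) 0 _
      (by rintro _ ⟨p, rfl⟩; exact hsol p) (by simp) ?_
    rintro _ ⟨p, rfl⟩ h
    have hsmall (i : ℕ) (hi : n + d ≤ i) : ‖PowerSeries.coeff i (φ p)‖ < ρ := by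
      refine lt_of_le_of_lt ?_ (half_lt_self hρ)
      rw [hφ, map_sum]
      exact IsUltrametricDist.norm_sum_le_of_forall_le_of_nonneg (by positivity) fun j _ =>
        norm_coeff_smul_le (p j).2 (by positivity) (hn j) hi
    ext i
    induction i using Nat.strong_induction_on with
    | _ i ih =>
      by_cases hi : i < n + d
      · exact h i (by omega)
      · exact hmin _ (addPoly_coeff_eq_zero (hsol p) ih) (hsmall i (not_lt.1 hi))
  by_contra! hm
  -- If m ≥ 5, this choice of d gives 20n+5 ≤ 20n+4.
  have h1 := hbound (4 * n + 1)
  have h2 : 5 * (4 * n + 1) ≤ m * (4 * n + 1) := Nat.mul_le_mul_right _ hm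
  omega

theorem rank_restrictedSol_le : Module.rank Fq[X] (restrictedSol Fq α η β γ δ) ≤ 4 := by
  refine rank_le fun s hs => ?_
  have h := (hs.map' (restrictedSol Fq α η β γ δ).subtype (Submodule.ker_subtype _)).comp _
    s.equivFin.symm.injective
  exact card_le_of_linearIndependent_restrictedSol (fun j => (s.equivFin.symm j).1.2) h

end UpperBound

/-! ### Convergent solutions from roots of the additive polynomial -/

section Lifts

variable [IsAlgClosed K]

/-- A root of minimal norm is compared with the coefficients of degrees 1 and q³. The bound with η
brings the first lift below norm 1; the other one controls all later lifts. -/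
theorem exists_addPoly_eq (Fq : Type*) [Field Fq] [Fintype Fq] [Algebra Fq K] (α η c : K) :
    ∃ b, addPoly Fq α η b = c ∧ ‖b‖ ≤ ‖c‖ ∧ ‖η‖ * ‖b‖ ^ Fintype.card Fq ^ 3 ≤ ‖c‖ := by
  have hdeg : 0 < (addPolySub Fq α η c).degree := by
    refine lt_of_lt_of_le (by simp) (Polynomial.le_degree_of_ne_zero (n := 1) ?_)
    rw [coeff_one_addPolySub]
    exact one_ne_zero
  obtain ⟨b, hb, h⟩ := (addPolySub Fq α η c).exists_root_norm_coeff_mul_pow_le hdeg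
  have h1 := h 1
  have h3 := h (Fintype.card Fq ^ 3)
  rw [coeff_one_addPolySub, coeff_zero_addPolySub] at h1
  rw [coeff_card_pow_three_addPolySub, coeff_zero_addPolySub] at h3
  rw [eval_addPolySub, sub_eq_zero] at hb
  exact ⟨b, hb, by simpa using h1, by simpa using h3⟩

/-- A solution of `addPoly α η b = c` of minimal norm. -/
def smallRoot (Fq : Type*) [Field Fq] [Fintype Fq] [Algebra Fq K] (α η c : K) : K :=
  (exists_addPoly_eq Fq α η c).choose

theorem smallRoot_spec (Fq : Type*) [Field Fq] [Fintype Fq] [Algebra Fq K] (α η c : K) :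
    addPoly Fq α η (smallRoot Fq α η c) = c ∧ ‖smallRoot Fq α η c‖ ≤ ‖c‖ ∧
      ‖η‖ * ‖smallRoot Fq α η c‖ ^ Fintype.card Fq ^ 3 ≤ ‖c‖ :=
  (exists_addPoly_eq Fq α η c).choose_spec

/-- The pairs `(bₙ, bₙ₋₁)` of consecutive coefficients of the solution starting with `b₀ = v` in
which each coefficient is chosen of minimal norm. -/
def liftSeq (Fq : Type*) [Field Fq] [Fintype Fq] [Algebra Fq K] (α η β γ δ v : K) : ℕ → K × K
  | 0 => (v, 0)
  | n + 1 =>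
    let b := liftSeq Fq α η β γ δ v n
    (smallRoot Fq α η (β * b.1 ^ Fintype.card Fq ^ 2 + γ * b.1 ^ Fintype.card Fq ^ 4 -
      δ * b.2 ^ Fintype.card Fq ^ 4), b.1)

/-- With m = max(u₀, u₁) < 1, every two steps gain at least a factor m, because squaring m^(k+1)
gives at most m^(k+2). -/
theorem tendsto_zero_of_le_max_sq {u : ℕ → ℝ} (hnn : ∀ n, 0 ≤ u n) (h0 : u 0 < 1) (h1 : u 1 < 1)
    (h : ∀ n, u n < 1 → u (n + 1) < 1 → u (n + 2) ≤ max (u (n + 1)) (u n) ^ 2) :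
    Filter.Tendsto u Filter.atTop (𝓝 0) := by
  set m := max (u 0) (u 1)
  have hm0 : 0 ≤ m := (hnn 0).trans (le_max_left _ _)
  have hm1 : m < 1 := max_lt h0 h1
  have step (n k : ℕ) (ha : u n ≤ m ^ (k + 1)) (hb : u (n + 1) ≤ m ^ (k + 1)) :
      u (n + 2) ≤ m ^ (k + 2) := by
    have hlt : m ^ (k + 1) < 1 := pow_lt_one₀ hm0 hm1 (by omega)
    refine (h n (ha.trans_lt hlt) (hb.trans_lt hlt)).trans
      ((pow_le_pow_left₀ ((hnn n).trans (le_max_right _ _)) (max_le hb ha) 2).trans ?_)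
    rw [← pow_mul]
    exact pow_le_pow_of_le_one hm0 hm1.le (by omega)
  have key (k : ℕ) : u (2 * k) ≤ m ^ (k + 1) ∧ u (2 * k + 1) ≤ m ^ (k + 1) := by
    induction k with
    | zero => simp [m]
    | succ k ih =>
      have h2 := step (2 * k) k ih.1 ih.2
      refine ⟨h2, step (2 * k + 1) k ih.2 (h2.trans ?_)⟩
      exact pow_le_pow_of_le_one hm0 hm1.le (by omega)
  refine squeeze_zero hnn (g := fun n => m ^ (n / 2)) (fun n => ?_)
    ((tendsto_pow_atTop_nhds_zero_of_lt_one hm0 hm1).comp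
      (Nat.tendsto_div_const_atTop two_ne_zero))
  refine le_trans ?_ (pow_le_pow_of_le_one hm0 hm1.le (Nat.le_succ (n / 2)))
  rcases Nat.even_or_odd' n with ⟨k, rfl | rfl⟩
  · simpa using (key k).1
  · simpa [Nat.mul_add_div] using (key k).2

theorem coeff_X_pow_one_mul_mk_liftSeq (v : K) (n : ℕ) :
    PowerSeries.coeff n (PowerSeries.X ^ 1 *
      PowerSeries.mk fun i => (liftSeq Fq α η β γ δ v i).1) = (liftSeq Fq α η β γ δ v n).2 := by
  rcases n with _ | n
  · simp [liftSeq]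
  · simp [liftSeq, PowerSeries.coeff_succ_X_mul]

theorem recOp_mk_liftSeq {v : K} (hv : addPoly Fq α η v = 0) :
    recOp Fq α η β γ δ (PowerSeries.mk fun n => (liftSeq Fq α η β γ δ v n).1) = 0 := by
  have hq : Fintype.card Fq ≠ 0 := Fintype.card_ne_zero
  rw [recOp_eq_zero_iff]
  intro n
  rcases n with _ | n
  · simpa [hq, liftSeq] using hv
  · have h : PowerSeries.coeff (n + 1) (PowerSeries.X ^ 2 *
        PowerSeries.mk fun i => (liftSeq Fq α η β γ δ v i).1) =
        (liftSeq Fq α η β γ δ v n).2 := by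
      rw [← coeff_X_pow_one_mul_mk_liftSeq, pow_one, pow_two, mul_assoc,
        PowerSeries.coeff_succ_X_mul]
    rw [h, coeff_X_pow_one_mul_mk_liftSeq, PowerSeries.coeff_mk, liftSeq,
      (smallRoot_spec Fq α η _).1]

theorem norm_add_sub_le_max {F : Type*} [SeminormedAddCommGroup F] [IsUltrametricDist F]
    (x y z : F) : ‖x + y - z‖ ≤ max (max ‖x‖ ‖y‖) ‖z‖ := by
  rw [sub_eq_add_neg, ← norm_neg z]
  exact (IsUltrametricDist.norm_add_le_max _ _).trans
    (max_le_max_right _ (IsUltrametricDist.norm_add_le_max _ _))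

/-- The root v itself may be large. It enters b₁ through β and γ, where a right-hand side of norm
below |η| still gives |b₁| < 1, and b₂ through δ. From two consecutive coefficients of norm below 1
on, the exponents q² and q⁴ force decay. -/
theorem exists_restrictedSol_coeff_zero_eq (hη : 1 ≤ ‖η‖) (hβ : ‖β‖ ≤ 1) (hγ : ‖γ‖ ≤ 1)
    (hδ : ‖δ‖ ≤ 1) {v : K} (hv : addPoly Fq α η v = 0)
    (h1 : ‖β * v ^ Fintype.card Fq ^ 2‖ < ‖η‖) (h2 : ‖γ * v ^ Fintype.card Fq ^ 4‖ < ‖η‖)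
    (h3 : ‖δ * v ^ Fintype.card Fq ^ 4‖ < 1) :
    ∃ f ∈ restrictedSol Fq α η β γ δ, PowerSeries.coeff 0 f = v := by
  have hq : Fintype.card Fq ≠ 0 := Fintype.card_ne_zero
  have hq2 : 2 ≤ Fintype.card Fq ^ 2 := one_lt_card_pow Fq two_ne_zero
  have hq4 : 2 ≤ Fintype.card Fq ^ 4 := one_lt_card_pow Fq four_ne_zero
  set b : ℕ → K := fun n => (liftSeq Fq α η β γ δ v n).1 with hb
  refine ⟨PowerSeries.mk b, ⟨recOp_mk_liftSeq hv, ?_⟩, by simp [hb, liftSeq]⟩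
  simp only [PowerSeries.coeff_mk]
  have hb1 : ‖b 1‖ < 1 := by
    have hs := (smallRoot_spec Fq α η (β * v ^ Fintype.card Fq ^ 2 +
      γ * v ^ Fintype.card Fq ^ 4 - δ * 0 ^ Fintype.card Fq ^ 4)).2.2
    have hc : ‖β * v ^ Fintype.card Fq ^ 2 + γ * v ^ Fintype.card Fq ^ 4 -
        δ * 0 ^ Fintype.card Fq ^ 4‖ < ‖η‖ :=
      (norm_add_sub_le_max _ _ _).trans_lt (max_lt (max_lt h1 h2) (by
        rw [zero_pow (pow_ne_zero 4 hq), mul_zero, norm_zero]; linarith))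
    by_contra! hb
    have := one_le_pow₀ (n := Fintype.card Fq ^ 3) hb
    exact absurd (hs.trans_lt hc) (not_lt.2 (le_mul_of_one_le_right (norm_nonneg η) this))
  have hrec (n : ℕ) : ‖b (n + 2)‖ ≤
      max (max ‖β * b (n + 1) ^ Fintype.card Fq ^ 2‖ ‖γ * b (n + 1) ^ Fintype.card Fq ^ 4‖)
        ‖δ * b n ^ Fintype.card Fq ^ 4‖ :=
    (smallRoot_spec Fq α η _).2.1.trans (norm_add_sub_le_max _ _ _)
  have hterm {c x : K} (hc : ‖c‖ ≤ 1) (hx : ‖x‖ ≤ 1) {k : ℕ} (hk : 2 ≤ k) :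
      ‖c * x ^ k‖ ≤ ‖x‖ ^ 2 := by
    rw [norm_mul, norm_pow]
    exact (mul_le_of_le_one_left (by positivity) hc).trans
      (pow_le_pow_of_le_one (norm_nonneg x) hx hk)
  have hb2 : ‖b 2‖ < 1 := by
    have hsq : ‖b 1‖ ^ 2 < 1 := pow_lt_one₀ (norm_nonneg _) hb1 two_ne_zero
    exact (hrec 0).trans_lt (max_lt (max_lt ((hterm hβ hb1.le hq2).trans_lt hsq)
      ((hterm hγ hb1.le hq4).trans_lt hsq)) h3)
  -- The index is shifted because only b₁ and b₂, not b₀, are known to have norm below 1.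
  rw [tendsto_zero_iff_norm_tendsto_zero, ← Filter.tendsto_add_atTop_iff_nat 1]
  refine tendsto_zero_of_le_max_sq (fun n => norm_nonneg _) hb1 hb2 fun n hn hn1 => ?_
  have hl : ‖b (n + 1)‖ ^ 2 ≤ max ‖b (n + 1 + 1)‖ ‖b (n + 1)‖ ^ 2 :=
    pow_le_pow_left₀ (norm_nonneg _) (le_max_right _ _) 2
  have hr : ‖b (n + 1 + 1)‖ ^ 2 ≤ max ‖b (n + 1 + 1)‖ ‖b (n + 1)‖ ^ 2 :=
    pow_le_pow_left₀ (norm_nonneg _) (le_max_left _ _) 2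
  exact (hrec (n + 1)).trans (max_le (max_le ((hterm hβ hn1.le hq2).trans hr)
    ((hterm hγ hn1.le hq4).trans hr)) ((hterm hδ hn.le hq4).trans hl))

/-- Solutions lifting an `Fq`-basis of the kernel are independent over `Fq[X]` by their constant
coefficients. -/
theorem finrank_restrictedSol [NeZero α] (hη : 1 ≤ ‖η‖) (hβ : ‖β‖ ≤ 1) (hγ : ‖γ‖ ≤ 1)
    (hδ : ‖δ‖ ≤ 1) (hv : ∀ v, addPoly Fq α η v = 0 → ‖β * v ^ Fintype.card Fq ^ 2‖ < ‖η‖ ∧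
      ‖γ * v ^ Fintype.card Fq ^ 4‖ < ‖η‖ ∧ ‖δ * v ^ Fintype.card Fq ^ 4‖ < 1) :
    Module.finrank Fq[X] (restrictedSol Fq α η β γ δ) = 4 := by
  refine Module.finrank_eq_of_rank_eq (rank_restrictedSol_le.antisymm ?_)
  let b := Module.finBasisOfFinrankEq Fq _ (finrank_ker_addPoly (Fq := Fq) (α := α) η)
  have hlift (j : Fin 4) : ∃ f ∈ restrictedSol Fq α η β γ δ,
      PowerSeries.coeff 0 f = (b j : K) := by
    have hj : addPoly Fq α η (b j) = 0 := (b j).2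
    exact exists_restrictedSol_coeff_zero_eq hη hβ hγ hδ hj (hv _ hj).1 (hv _ hj).2.1
      (hv _ hj).2.2
  choose f hf hfb using hlift
  have hli : LinearIndependent Fq[X] f := by
    refine linearIndependent_of_coeff_zero ?_
    simp only [hfb]
    exact b.linearIndependent.map' (LinearMap.ker (addPoly Fq α η)).subtype
      (Submodule.ker_subtype _)
  have hli' : LinearIndependent Fq[X] fun j => (⟨f j, hf j⟩ : restrictedSol Fq α η β γ δ) :=
    LinearIndependent.of_comp (restrictedSol Fq α η β γ δ).subtype hli
  simpa using hli'.cardinal_lift_le_rank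

end Lifts

/-! ### Absence of convergent solutions when η = 0 -/

section Vanishing

theorem norm_eq_one_of_norm_mul_pow_add_eq_one {a y : K} (ha : ‖a‖ = 1) {k : ℕ} (hk : 1 < k)
    (h : ‖a * y ^ k + y‖ = 1) : ‖y‖ = 1 := by
  have hak : ‖a * y ^ k‖ = ‖y‖ ^ k := by rw [norm_mul, ha, one_mul, norm_pow]
  rcases lt_trichotomy ‖y‖ 1 with hy | hy | hy
  · have := IsUltrametricDist.norm_add_le_max (a * y ^ k) y
    rw [h, hak] at this
    exact absurd this (not_le.2 (max_lt (pow_lt_one₀ (norm_nonneg y) hy (by omega)) hy))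
  · exact hy
  · have hlt : ‖y‖ < ‖y‖ ^ k := by simpa using pow_lt_pow_right₀ hy hk
    rw [IsUltrametricDist.norm_add_eq_max_of_norm_ne_norm (by rw [hak]; exact hlt.ne'), hak,
      max_eq_left hlt.le] at h
    linarith

/-- The first nonzero coefficient is a root of αx^(q⁴) + x, so it has norm 1. After that the β-term
has norm 1 and dominates the terms with γ and δ, so every later coefficient also has norm 1. -/
theorem restrictedSol_eq_bot (hα : ‖α‖ = 1) (hβ : ‖β‖ = 1) (hγ : ‖γ‖ < 1) (hδ : ‖δ‖ < 1) :
    restrictedSol Fq α 0 β γ δ = ⊥ := by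
  classical
  have hq4 : 1 < Fintype.card Fq ^ 4 := one_lt_card_pow Fq four_ne_zero
  rw [Submodule.eq_bot_iff]
  intro f hf
  by_contra hf0
  have hex : ∃ n, PowerSeries.coeff n f ≠ 0 := by
    by_contra! h
    exact hf0 (PowerSeries.ext h)
  obtain ⟨N, hN, hmin⟩ : ∃ N, PowerSeries.coeff N f ≠ 0 ∧
      ∀ i < N, PowerSeries.coeff i f = 0 :=
    ⟨Nat.find hex, Nat.find_spec hex, fun i hi => not_not.1 (Nat.find_min hex hi)⟩
  have hN1 : ‖PowerSeries.coeff N f‖ = 1 := by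
    have h := addPoly_coeff_eq_zero hf.1 hmin
    rw [addPoly_apply, zero_mul, sub_zero, add_eq_zero_iff_eq_neg] at h
    replace h := congrArg norm h
    rw [norm_neg, norm_mul, hα, one_mul, norm_pow] at h
    rcases lt_trichotomy ‖PowerSeries.coeff N f‖ 1 with hy | hy | hy
    · exact absurd h (pow_lt_self_of_lt_one₀ (norm_pos_iff.2 hN) hy hq4).ne
    · exact hy
    · exact absurd h (lt_self_pow₀ hy hq4).ne'
  have key (k : ℕ) : (∀ i ≤ N + k, ‖PowerSeries.coeff i f‖ ≤ 1) ∧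
      ‖PowerSeries.coeff (N + k) f‖ = 1 := by
    induction k with
    | zero =>
      refine ⟨fun i hi => ?_, hN1⟩
      rcases hi.lt_or_eq with hi | rfl
      · simp [hmin i hi]
      · exact hN1.le
    | succ k ih =>
      have hstep : ‖PowerSeries.coeff (N + (k + 1)) f‖ = 1 := by
        have h := (recOp_eq_zero_iff _ _ _ _ _ _).1 hf.1 (N + (k + 1))
        rw [addPoly_apply, zero_mul, sub_zero] at h
        refine norm_eq_one_of_norm_mul_pow_add_eq_one hα hq4 ?_
        have h1 : PowerSeries.coeff (N + (k + 1)) (PowerSeries.X ^ 1 * f) =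
            PowerSeries.coeff (N + k) f := by
          rw [pow_one, ← add_assoc, PowerSeries.coeff_succ_X_mul]
        have h2 : ‖PowerSeries.coeff (N + (k + 1)) (PowerSeries.X ^ 2 * f)‖ ≤ 1 := by
          rw [PowerSeries.coeff_X_pow_mul']
          split_ifs
          · exact ih.1 _ (by omega)
          · simp
        rw [h, h1, add_sub_assoc]
        have hb : ‖β * PowerSeries.coeff (N + k) f ^ Fintype.card Fq ^ 2‖ = 1 := by
          rw [norm_mul, norm_pow, hβ, ih.2, one_pow, one_mul]
        have hsmall : ‖γ * PowerSeries.coeff (N + k) f ^ Fintype.card Fq ^ 4 -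
            δ * PowerSeries.coeff (N + (k + 1)) (PowerSeries.X ^ 2 * f) ^
              Fintype.card Fq ^ 4‖ < 1 := by
          rw [sub_eq_add_neg]
          refine (IsUltrametricDist.norm_add_le_max _ _).trans_lt (max_lt ?_ ?_)
          · rwa [norm_mul, norm_pow, ih.2, one_pow, mul_one]
          · rw [norm_neg, norm_mul, norm_pow]
            exact (mul_le_of_le_one_right (norm_nonneg _)
              (pow_le_one₀ (norm_nonneg _) h2)).trans_lt hδ
        rw [IsUltrametricDist.norm_add_eq_max_of_norm_ne_norm (by rw [hb]; exact hsmall.ne'), hb,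
          max_eq_left hsmall.le]
      refine ⟨fun i hi => ?_, hstep⟩
      rcases hi.lt_or_eq with hi | rfl
      · exact ih.1 i (by omega)
      · exact hstep.le
  have hlim := (tendsto_zero_iff_norm_tendsto_zero.1 hf.2).comp (Filter.tendsto_add_atTop_nat N)
  have hone : Filter.Tendsto (fun _ : ℕ => (1 : ℝ)) Filter.atTop (𝓝 0) :=
    hlim.congr fun k => by simpa [add_comm] using (key k).2
  exact one_ne_zero (tendsto_nhds_unique tendsto_const_nhds hone)

end Vanishing

end RestrictedSolutions

/-! ### `M(A, N)` as a t-motive of rank 2n -/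

section MotiveStructure

variable {Fq : Type*} [Field Fq] [Fintype Fq] {n : ℕ}

/-- This makes τM a `ℂ_∞[T]`-submodule. -/
instance : RingHomSurjective (frobPoly Fq) :=
  ⟨Polynomial.map_surjective _ (frob_surjective Fq)⟩

theorem frobPoly_C (c : CInfty Fq) : frobPoly Fq (Polynomial.C c) = Polynomial.C (frob Fq c) :=
  Polynomial.map_C _

theorem frobPoly_X : frobPoly Fq Polynomial.X = Polynomial.X := Polynomial.map_X _

variable (A N : Matrix (Fin n) (Fin n) (CInfty Fq))

/-- The `ℂ_∞`-basis `τ ^ j eᵢ` of `M(A, N)`. -/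
def tauBasis : Module.Basis (Fin n × ℕ) (CInfty Fq) (MotiveAN A N) :=
  ((Pi.basis fun _ : Fin n => (SkewMonoidAlgebra.basisSingleOne (k := CInfty Fq)
    (G := Multiplicative ℕ)).reindex Multiplicative.toAdd).reindex
      (Equiv.sigmaEquivProd (Fin n) ℕ)).map (Module.AEval'.of (tAction A N))

theorem tauBasis_apply (i : Fin n) (j : ℕ) : tauBasis A N (i, j) =
    Module.AEval'.of (tAction A N) (Pi.single i (SkewPolynomial.monomial j 1)) := by
  rw [tauBasis, Module.Basis.map_apply, Module.Basis.reindex_apply]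
  congr 1
  rw [Equiv.sigmaEquivProd_symm_apply, Pi.basis_apply]
  congr 1
  rw [Module.Basis.reindex_apply]
  exact Module.Basis.apply_eq_iff.2 rfl

theorem tauAN_tauBasis (i : Fin n) (j : ℕ) :
    tauAN A N (tauBasis A N (i, j)) = tauBasis A N (i, j + 1) := by
  rw [tauBasis_apply, tauBasis_apply]
  change Module.AEval'.of (tAction A N) ((SkewPolynomial.X : SkewPolynomial (CInfty Fq)) •
    (Module.AEval'.of (tAction A N)).symm (Module.AEval'.of (tAction A N) _)) = _
  rw [LinearEquiv.symm_apply_apply, ← Pi.single_smul (f := fun _ => SkewPolynomial (CInfty Fq)),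
    smul_eq_mul, SkewPolynomial.X_mul_monomial, map_one]

theorem hasDimension_tauAN : HasDimension (tauAN A N) n :=
  ⟨tauBasis A N, fun i j => (tauAN_tauBasis A N i j).symm⟩

theorem C_smul_motive (c : CInfty Fq) (x : MotiveAN A N) :
    (Polynomial.C c : (CInfty Fq)[X]) • x = c • x :=
  algebraMap_smul (CInfty Fq)[X] c x

theorem X_smul_tauBasis_zero (i : Fin n) :
    (Polynomial.X : (CInfty Fq)[X]) • tauBasis A N (i, 0) =
      theta Fq • tauBasis A N (i, 0) + ∑ k, N i k • tauBasis A N (k, 0) +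
        ∑ k, A i k • tauBasis A N (k, 1) + tauBasis A N (i, 2) := by
  simp only [tauBasis_apply, Module.AEval'.X_smul_of]
  simp only [← map_smul, ← map_sum, ← map_add]
  congr 1
  have hs (m : ℕ) (c : Fin n → CInfty Fq) (l : Fin n) :
      (∑ k, c k • (Pi.single k (SkewPolynomial.monomial m 1) :
        Fin n → SkewPolynomial (CInfty Fq))) l = SkewPolynomial.monomial m (c l) := by
    rw [Finset.sum_apply, Finset.sum_eq_single l]
    · simp [SkewPolynomial.smul_monomial]
    · intro k _ hk
      simp [Pi.single_eq_of_ne hk.symm]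
    · simp
  have hvec : tAction A N (Pi.single i (SkewPolynomial.monomial 0 1)) = matrixAN A N i := by
    change Matrix.vecMul _ (matrixAN A N) = _
    rw [SkewPolynomial.monomial_zero_one, Matrix.single_one_vecMul]
    rfl
  rw [hvec]
  ext1 l
  simp only [Pi.add_apply, hs]
  rw [matrixAN, Matrix.of_apply]
  rcases eq_or_ne i l with rfl | h
  · simp [SkewPolynomial.smul_monomial, -SkewPolynomial.monomial_zero_left]
  · simp [Matrix.one_apply_ne h, Pi.single_eq_of_ne h.symm]

theorem tauAN_smul (c : CInfty Fq) (x : MotiveAN A N) :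
    tauAN A N (c • x) = frob Fq c • tauAN A N x := by
  rw [← C_smul_motive, map_smulₛₗ, frobPoly_C, C_smul_motive]

theorem tauAN_X_smul (x : MotiveAN A N) :
    tauAN A N ((Polynomial.X : (CInfty Fq)[X]) • x) =
      (Polynomial.X : (CInfty Fq)[X]) • tauAN A N x := by
  rw [map_smulₛₗ, frobPoly_X]

theorem tauBasis_induction {p : MotiveAN A N → Prop} (hz : p 0)
    (h0 : ∀ i j, p (tauBasis A N (i, j)))
    (hadd : ∀ x y, p x → p y → p (x + y)) (hsmul : ∀ (c : CInfty Fq) x, p x → p (c • x))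
    (x : MotiveAN A N) : p x := by
  have hx : x ∈ Submodule.span (CInfty Fq) (Set.range (tauBasis A N)) := by
    rw [(tauBasis A N).span_eq]; trivial
  induction hx using Submodule.span_induction with
  | mem x hx => obtain ⟨⟨i, j⟩, rfl⟩ := hx; exact h0 i j
  | zero => exact hz
  | add x y _ _ hx hy => exact hadd x y hx hy
  | smul c x _ hx => exact hsmul c x hx

/-- The map that `τ` induces on coordinates with respect to the `ℂ_∞[T]`-basis `eᵢ, τ eᵢ`. -/
def frameTau : (Fin n ⊕ Fin n → (CInfty Fq)[X]) →ₛₗ[frobPoly Fq]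
    (Fin n ⊕ Fin n → (CInfty Fq)[X]) where
  toFun w := Sum.elim
    (fun k => (Polynomial.X - Polynomial.C (theta Fq)) * frobPoly Fq (w (Sum.inr k)) -
      ∑ i, frobPoly Fq (w (Sum.inr i)) * Polynomial.C (N i k))
    (fun k => frobPoly Fq (w (Sum.inl k)) -
      ∑ i, frobPoly Fq (w (Sum.inr i)) * Polynomial.C (A i k))
  map_add' v w := by
    ext1 k
    rcases k with k | k <;>
    · simp only [Sum.elim_inl, Sum.elim_inr, Pi.add_apply, map_add, add_mul,
        Finset.sum_add_distrib]
      ring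
  map_smul' p w := by
    ext1 k
    rcases k with k | k
    · simp only [Sum.elim_inl, Pi.smul_apply, smul_eq_mul, map_mul, mul_sub,
        Finset.mul_sum, mul_assoc]
      ring
    · simp only [Sum.elim_inr, Pi.smul_apply, smul_eq_mul, map_mul, mul_sub,
        Finset.mul_sum, mul_assoc]

theorem frameTau_inl (i : Fin n) : frameTau A N (Pi.single (Sum.inl i) 1) =
    Pi.single (Sum.inr i) 1 := by
  ext1 k
  rcases k with k | k
  · simp [frameTau]
  · rcases eq_or_ne k i with rfl | h
    · simp [frameTau]
    · simp [frameTau, Pi.single_eq_of_ne, h]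

theorem frameTau_inr (i : Fin n) : frameTau A N (Pi.single (Sum.inr i) 1) =
    (Polynomial.X - Polynomial.C (theta Fq)) • Pi.single (Sum.inl i) 1 -
      (∑ k, Polynomial.C (N i k) • Pi.single (Sum.inl k) 1 +
        ∑ k, Polynomial.C (A i k) • Pi.single (Sum.inr k) 1) := by
  ext1 k
  rcases k with k | k
  · simp only [frameTau, LinearMap.coe_mk, AddHom.coe_mk, Sum.elim_inl]
    rcases eq_or_ne k i with rfl | h
    · simp [Finset.sum_apply, Pi.single_apply]
    · simp [Finset.sum_apply, Pi.single_apply, h]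
  · simp only [frameTau, LinearMap.coe_mk, AddHom.coe_mk, Sum.elim_inr]
    simp [Finset.sum_apply, Pi.single_apply]

/-- The coordinates with respect to the `ℂ_∞[T]`-basis `eᵢ, τ eᵢ`, as a `ℂ_∞`-linear map. -/
def frameCoord : MotiveAN A N →ₗ[CInfty Fq] (Fin n ⊕ Fin n → (CInfty Fq)[X]) :=
  (tauBasis A N).constr (CInfty Fq) fun p =>
    (frameTau A N)^[p.2] (Pi.single (Sum.inl p.1) 1)

theorem frameCoord_tauBasis (i : Fin n) (j : ℕ) : frameCoord A N (tauBasis A N (i, j)) =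
    (frameTau A N)^[j] (Pi.single (Sum.inl i) 1) :=
  (tauBasis A N).constr_basis _ _ _

theorem C_smul_frame (c : CInfty Fq) (w : Fin n ⊕ Fin n → (CInfty Fq)[X]) :
    (Polynomial.C c : (CInfty Fq)[X]) • w = c • w :=
  algebraMap_smul (CInfty Fq)[X] c w

theorem frameCoord_tauAN (x : MotiveAN A N) :
    frameCoord A N (tauAN A N x) = frameTau A N (frameCoord A N x) := by
  induction x using tauBasis_induction with
  | hz => simp
  | h0 i j =>
    rw [tauAN_tauBasis, frameCoord_tauBasis, frameCoord_tauBasis, Function.iterate_succ_apply']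
  | hadd x y hx hy => rw [map_add, map_add, map_add, map_add, hx, hy]
  | hsmul c x hx =>
    rw [tauAN_smul, map_smul, map_smul, ← C_smul_frame, ← C_smul_frame, map_smulₛₗ, frobPoly_C, hx]

/-- On eᵢ this is the formula for τ²eᵢ built into `frameTau`; it passes to τʲeᵢ because T commutes
with τ on both sides. -/
theorem frameCoord_X_smul (x : MotiveAN A N) :
    frameCoord A N ((Polynomial.X : (CInfty Fq)[X]) • x) =
      (Polynomial.X : (CInfty Fq)[X]) • frameCoord A N x := by
  induction x using tauBasis_induction with
  | hz => simp
  | h0 i j =>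
    induction j with
    | zero =>
      rw [X_smul_tauBasis_zero]
      simp only [map_add, map_sum, map_smul, frameCoord_tauBasis, Function.iterate_succ,
        Function.iterate_zero, Function.comp_apply, id_eq, frameTau_inl, frameTau_inr]
      simp only [← C_smul_frame, sub_smul]
      abel
    | succ j ih =>
      rw [← tauAN_tauBasis, ← tauAN_X_smul, frameCoord_tauAN, ih, map_smulₛₗ, frobPoly_X,
        frameCoord_tauAN]
  | hadd x y hx hy => rw [smul_add, map_add, map_add, hx, hy, smul_add]
  | hsmul c x hx => rw [smul_comm, map_smul, hx, map_smul, smul_comm]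

theorem frameCoord_smul (p : (CInfty Fq)[X]) (x : MotiveAN A N) :
    frameCoord A N (p • x) = p • frameCoord A N x := by
  induction p using Polynomial.induction_on generalizing x with
  | C c => rw [C_smul_motive, map_smul, C_smul_frame]
  | add p r hp hr => rw [add_smul, map_add, hp, hr, add_smul]
  | monomial k c ih =>
    rw [pow_succ, ← mul_assoc, mul_smul, ih, frameCoord_X_smul, ← mul_smul]

/-- The family `eᵢ, τ eᵢ`. -/
def frame : Fin n ⊕ Fin n → MotiveAN A N :=
  Sum.elim (fun i => tauBasis A N (i, 0)) fun i => tauBasis A N (i, 1)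

/-- The coordinate map, now known to be `ℂ_∞[T]`-linear, sends the family to the standard basis. -/
theorem linearIndependent_frame : LinearIndependent (CInfty Fq)[X] (frame A N) := by
  let f : MotiveAN A N →ₗ[(CInfty Fq)[X]] (Fin n ⊕ Fin n → (CInfty Fq)[X]) :=
    { frameCoord A N with map_smul' := frameCoord_smul A N }
  refine LinearIndependent.of_comp f ?_
  convert (Pi.basisFun (CInfty Fq)[X] (Fin n ⊕ Fin n)).linearIndependent using 1
  ext1 k
  rw [Pi.basisFun_apply, Function.comp_apply]
  change frameCoord A N (frame A N k) = _
  rcases k with i | i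
  · simp [frame, frameCoord_tauBasis]
  · simp [frame, frameCoord_tauBasis, frameTau_inl]

theorem tauAN_frame_inl (i : Fin n) :
    tauAN A N (frame A N (Sum.inl i)) = frame A N (Sum.inr i) :=
  tauAN_tauBasis A N i 0

theorem tauAN_frame_inr (i : Fin n) : tauAN A N (frame A N (Sum.inr i)) =
    (Polynomial.X - Polynomial.C (theta Fq)) • frame A N (Sum.inl i) -
      (∑ k, Polynomial.C (N i k) • frame A N (Sum.inl k) +
        ∑ k, Polynomial.C (A i k) • frame A N (Sum.inr k)) := by
  simp only [frame, Sum.elim_inl, Sum.elim_inr, tauAN_tauBasis, sub_smul, X_smul_tauBasis_zero,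
    C_smul_motive]
  abel

/-- The span is stable under τ and contains the eᵢ, hence all τʲeᵢ. -/
theorem span_frame : Submodule.span (CInfty Fq)[X] (Set.range (frame A N)) = ⊤ := by
  set S := Submodule.span (CInfty Fq)[X] (Set.range (frame A N)) with hS
  have hmem (k) : frame A N k ∈ S := Submodule.subset_span ⟨k, rfl⟩
  have htau (x : MotiveAN A N) (hx : x ∈ S) : tauAN A N x ∈ S := by
    induction hx using Submodule.span_induction with
    | mem x hx =>
      obtain ⟨i | i, rfl⟩ := hx
      · rw [tauAN_frame_inl]; exact hmem _
      · rw [tauAN_frame_inr]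
        exact S.sub_mem (S.smul_mem _ (hmem _)) (S.add_mem
          (S.sum_mem fun k _ => S.smul_mem _ (hmem _))
          (S.sum_mem fun k _ => S.smul_mem _ (hmem _)))
    | zero => simp
    | add x y _ _ hx hy => rw [map_add]; exact S.add_mem hx hy
    | smul p x _ hx => rw [map_smulₛₗ]; exact S.smul_mem _ hx
  rw [Submodule.eq_top_iff']
  intro x
  induction x using tauBasis_induction with
  | hz => exact S.zero_mem
  | h0 i j =>
    induction j with
    | zero => exact hmem (Sum.inl i)
    | succ j ih => rw [← tauAN_tauBasis]; exact htau _ ih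
  | hadd x y hx hy => exact S.add_mem hx hy
  | hsmul c x hx => rw [← C_smul_motive]; exact S.smul_mem _ hx

/-- `eᵢ, τ eᵢ` as a `ℂ_∞[T]`-basis of `M(A, N)`. -/
def frameBasis : Module.Basis (Fin n ⊕ Fin n) (CInfty Fq)[X] (MotiveAN A N) :=
  Module.Basis.mk (linearIndependent_frame A N) (span_frame A N).ge

theorem frameBasis_apply (k : Fin n ⊕ Fin n) : frameBasis A N k = frame A N k :=
  Module.Basis.mk_apply _ _ _

theorem finrank_motiveAN : Module.finrank (CInfty Fq)[X] (MotiveAN A N) = 2 * n := by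
  rw [Module.finrank_eq_card_basis (frameBasis A N)]
  simp [two_mul]

theorem X_sub_theta_smul_tauBasis_zero_sub_mem (i : Fin n) :
    (Polynomial.X - Polynomial.C (theta Fq)) • tauBasis A N (i, 0) -
      ∑ k, N i k • tauBasis A N (k, 0) ∈ LinearMap.range (tauAN A N) := by
  have h : (Polynomial.X - Polynomial.C (theta Fq)) • tauBasis A N (i, 0) -
      ∑ k, N i k • tauBasis A N (k, 0) =
      ∑ k, (Polynomial.C (A i k) : (CInfty Fq)[X]) • tauBasis A N (k, 1) + tauBasis A N (i, 2) := by
    rw [sub_smul, X_smul_tauBasis_zero, C_smul_motive]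
    simp only [C_smul_motive]
    abel
  have hr (k : Fin n) (j : ℕ) : tauBasis A N (k, j + 1) ∈ LinearMap.range (tauAN A N) :=
    ⟨_, tauAN_tauBasis A N k j⟩
  rw [h]
  exact add_mem (sum_mem fun k _ => Submodule.smul_mem _ _ (hr k 0)) (hr i 1)

/-- Modulo τM, multiplication by T-θ acts on the eᵢ through N; nilpotency of N then kills M/τM. -/
theorem X_sub_theta_pow_smul_sub_mem (m : ℕ) (c : Fin n → CInfty Fq) :
    (Polynomial.X - Polynomial.C (theta Fq)) ^ m • ∑ i, c i • tauBasis A N (i, 0) -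
      ∑ i, (Matrix.vecMul c (N ^ m)) i • tauBasis A N (i, 0) ∈ LinearMap.range (tauAN A N) := by
  induction m generalizing c with
  | zero => simp
  | succ m ih =>
    have h1 : (Polynomial.X - Polynomial.C (theta Fq)) • ∑ i, c i • tauBasis A N (i, 0) -
        ∑ i, (Matrix.vecMul c N) i • tauBasis A N (i, 0) ∈ LinearMap.range (tauAN A N) := by
      have h : (Polynomial.X - Polynomial.C (theta Fq)) • ∑ i, c i • tauBasis A N (i, 0) -
          ∑ i, (Matrix.vecMul c N) i • tauBasis A N (i, 0) =
          ∑ i, (Polynomial.C (c i) : (CInfty Fq)[X]) •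
            ((Polynomial.X - Polynomial.C (theta Fq)) • tauBasis A N (i, 0) -
              ∑ k, N i k • tauBasis A N (k, 0)) := by
        simp only [Matrix.vecMul, dotProduct, C_smul_motive, smul_sub, Finset.sum_sub_distrib,
          Finset.smul_sum, Finset.sum_smul, mul_smul]
        congr 1
        · exact Finset.sum_congr rfl fun i _ => smul_comm _ _ _
        · exact Finset.sum_comm
      rw [h]
      exact sum_mem fun i _ =>
        Submodule.smul_mem _ _ (X_sub_theta_smul_tauBasis_zero_sub_mem A N i)
    have h2 := ih (Matrix.vecMul c N)
    rw [Matrix.vecMul_vecMul, ← pow_succ'] at h2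
    have h3 := add_mem (Submodule.smul_mem _
      ((Polynomial.X - Polynomial.C (theta Fq)) ^ m) h1) h2
    rwa [smul_sub, ← mul_smul, ← pow_succ, sub_add_sub_cancel] at h3

theorem isTMotive_tauAN {m : ℕ} (hN : N ^ m = 0) : IsTMotive (tauAN A N) where
  free := Module.Free.of_basis (frameBasis A N)
  finite := Module.Finite.of_basis (frameBasis A N)
  free_tau := ⟨n, hasDimension_tauAN A N⟩
  nilpotent := by
    refine ⟨m, fun x => ?_⟩
    change _ ∈ LinearMap.range (tauAN A N)
    induction x using tauBasis_induction with
    | hz => simp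
    | h0 i j =>
      rcases j with _ | j
      · have h := X_sub_theta_pow_smul_sub_mem A N m (Pi.single i 1)
        simpa [hN, Pi.single_apply, ite_smul] using h
      · exact Submodule.smul_mem _ _ ⟨_, tauAN_tauBasis A N i j⟩
    | hadd x y hx hy => rw [smul_add]; exact add_mem hx hy
    | hsmul c x hx =>
      rw [← C_smul_motive, smul_comm]
      exact Submodule.smul_mem _ _ hx

end MotiveStructure

/-! ### Coordinates on M ⊗ `ℂ_∞{T}` -/

section TensorCoordinates

variable {Fq : Type*} [Field Fq] [Fintype Fq] {n : ℕ} (A N : Matrix (Fin n) (Fin n) (CInfty Fq))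

/-- The coordinates of `M(A, N) ⊗ ℂ_∞{T}` with respect to the basis `eᵢ, τ eᵢ`. -/
def tensorCoord : MotiveAN A N ⊗[(CInfty Fq)[X]] TateAlg Fq ≃ₗ[(CInfty Fq)[X]]
    (Fin n ⊕ Fin n →₀ TateAlg Fq) :=
  TensorProduct.equivFinsuppOfBasisLeft (frameBasis A N)

theorem tensorCoord_frame_tmul (k : Fin n ⊕ Fin n) (s : TateAlg Fq) :
    tensorCoord A N (frame A N k ⊗ₜ s) = Finsupp.single k s := by
  classical
  ext1 l
  rw [tensorCoord, ← frameBasis_apply, TensorProduct.equivFinsuppOfBasisLeft_apply_tmul_apply,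
    Module.Basis.repr_self, Finsupp.single_apply, Finsupp.single_apply, ite_smul, one_smul,
    zero_smul]

theorem tensorCoord_tauTensor (x : MotiveAN A N ⊗[(CInfty Fq)[X]] TateAlg Fq) (k : Fin n) :
    tensorCoord A N (tauTensor (tauAN A N) x) (Sum.inl k) =
      (Polynomial.X - Polynomial.C (theta Fq)) • frobTate Fq (tensorCoord A N x (Sum.inr k)) -
        ∑ i, Polynomial.C (N i k) • frobTate Fq (tensorCoord A N x (Sum.inr i)) ∧
    tensorCoord A N (tauTensor (tauAN A N) x) (Sum.inr k) =
      frobTate Fq (tensorCoord A N x (Sum.inl k)) -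
        ∑ i, Polynomial.C (A i k) • frobTate Fq (tensorCoord A N x (Sum.inr i)) := by
  classical
  obtain ⟨g, rfl⟩ := (tensorCoord A N).symm.surjective x
  induction g using Finsupp.induction_linear with
  | zero => simp
  | add f g hf hg =>
    simp only [map_add, Finsupp.add_apply, smul_add, Finset.sum_add_distrib, hf.1, hf.2, hg.1,
      hg.2]
    constructor <;> abel
  | single l s =>
    rw [← tensorCoord_frame_tmul, LinearEquiv.symm_apply_apply]
    have ht : tauTensor (tauAN A N) (frame A N l ⊗ₜ s) = tauAN A N (frame A N l) ⊗ₜ frobTate Fq s :=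
      rfl
    rw [ht, tensorCoord_frame_tmul]
    rcases l with i | i
    · rw [tauAN_frame_inl, tensorCoord_frame_tmul]
      simp [Finsupp.single_apply, apply_ite (frobTate Fq)]
    · rw [tauAN_frame_inr, TensorProduct.sub_tmul, TensorProduct.add_tmul, TensorProduct.sum_tmul,
        TensorProduct.sum_tmul]
      simp only [← TensorProduct.smul_tmul', map_sub, map_add, map_sum, map_smul,
        tensorCoord_frame_tmul]
      simp [Finsupp.single_apply, apply_ite (frobTate Fq)]

end TensorCoordinates

/-! ### The Newton polygon estimate -/

section Slopes

/-- Here k = q-1, Q = q, a = |a₂₁| and u is the norm of a root of αx^(q⁴) - a₂₁x^(q³) + x. The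
steepest slope gives u ≤ q^(1/(q(q-1)²)); the conclusions are what the lifting of roots requires.
Powers k² are compared to keep all exponents integral. -/
theorem lt_of_newton_slope {k : ℕ} (hk : 2 ≤ k) {Q a u : ℝ} (hQ : 1 < Q) (ha : 1 ≤ a)
    (hak : a ^ k = Q ^ (k + 1) ^ 2) (hu0 : 0 ≤ u)
    (hu : u ^ (k + 1) ^ 4 ≤ max (a * u ^ (k + 1) ^ 3) u) :
    u ^ (k + 1) ^ 2 < a ∧ u ^ (k + 1) ^ 4 < a * Q ^ (k + 1) ^ 2 ∧
      u ^ (k + 1) ^ 4 < Q ^ ((k + 1) ^ 3 + (k + 1) ^ 2) := by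
  have hkey : u ^ ((k + 1) * k ^ 2) ≤ Q := by
    rcases le_or_gt u 1 with h1 | h1
    · exact (pow_le_one₀ hu0 h1).trans hQ.le
    · have hmax : max (a * u ^ (k + 1) ^ 3) u = a * u ^ (k + 1) ^ 3 := by
        refine max_eq_left ?_
        calc u ≤ u ^ (k + 1) ^ 3 := le_self_pow₀ h1.le (by positivity)
          _ ≤ a * u ^ (k + 1) ^ 3 := le_mul_of_one_le_left (by positivity) ha
      have h2 : u ^ ((k + 1) ^ 3 * k) ≤ a := by
        rw [hmax, show (k + 1) ^ 4 = (k + 1) ^ 3 * k + (k + 1) ^ 3 by ring, pow_add] at hu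
        exact le_of_mul_le_mul_right hu (by positivity)
      have h3 := pow_le_pow_left₀ (by positivity) h2 k
      rw [hak, ← pow_mul, show (k + 1) ^ 3 * k * k = (k + 1) * k ^ 2 * (k + 1) ^ 2 by ring,
        pow_mul] at h3
      exact le_of_pow_le_pow_left₀ (by positivity) (by linarith) h3
  have hpow (e : ℕ) : (u ^ ((k + 1) * e)) ^ k ^ 2 ≤ Q ^ e := by
    rw [← pow_mul, show (k + 1) * e * k ^ 2 = (k + 1) * k ^ 2 * e by ring, pow_mul]
    exact pow_le_pow_left₀ (by positivity) hkey e
  have hak2 : a ^ k ^ 2 = Q ^ ((k + 1) ^ 2 * k) := by rw [pow_two k, pow_mul, hak, ← pow_mul]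
  have h0 : (0 : ℝ) < Q := by linarith
  refine ⟨?_, ?_, ?_⟩
  · refine lt_of_pow_lt_pow_left₀ (k ^ 2) (by linarith) ?_
    rw [hak2, show (k + 1) ^ 2 = (k + 1) * (k + 1) by ring]
    exact (hpow (k + 1)).trans_lt (pow_lt_pow_right₀ hQ (by nlinarith))
  · refine lt_of_pow_lt_pow_left₀ (k ^ 2) (by positivity) ?_
    rw [mul_pow, hak2, ← pow_mul Q, ← pow_add, show (k + 1) ^ 4 = (k + 1) * (k + 1) ^ 3 by ring,
      show (k + 1) ^ 2 * k + (k + 1) ^ 2 * k ^ 2 = (k + 1) ^ 3 * k by ring]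
    -- This is where q > 2 is essential: for k = 1 the two exponents coincide.
    exact (hpow _).trans_lt (pow_lt_pow_right₀ hQ (lt_mul_of_one_lt_right (by positivity) hk))
  · refine lt_of_pow_lt_pow_left₀ (k ^ 2) (by positivity) ?_
    rw [← pow_mul Q, show (k + 1) ^ 4 = (k + 1) * (k + 1) ^ 3 by ring]
    refine (hpow _).trans_lt (pow_lt_pow_right₀ hQ ?_)
    calc (k + 1) ^ 3 < (k + 1) ^ 3 + (k + 1) ^ 2 := Nat.lt_add_of_pos_right (by positivity)
      _ ≤ _ := Nat.le_mul_of_pos_right _ (by positivity)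

end Slopes

/-! ### Elimination of all coordinates but one -/

section FrobeniusRules

variable {Fq K : Type*} [Field Fq] [Fintype Fq] [Field K] [Algebra Fq K]

theorem frobSeries_mul (f g : K⟦X⟧) :
    frobSeries Fq K (f * g) = frobSeries Fq K f * frobSeries Fq K g := by
  simpa using frobSeries_pow_mul (Fq := Fq) 1 f g

theorem frobSeries_X : frobSeries Fq K PowerSeries.X = PowerSeries.X := by
  simpa using frobSeries_pow_X (Fq := Fq) (K := K) 1

theorem coeff_frobSeries (n : ℕ) (f : K⟦X⟧) : PowerSeries.coeff n (frobSeries Fq K f) =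
    PowerSeries.coeff n f ^ Fintype.card Fq := by
  simpa using coeff_frobSeries_pow (Fq := Fq) 1 n f

theorem frobSeries_C (c : K) : frobSeries Fq K (PowerSeries.C c) =
    PowerSeries.C (c ^ Fintype.card Fq) := by
  ext n
  rw [coeff_frobSeries, PowerSeries.coeff_C, PowerSeries.coeff_C]
  split_ifs
  · rfl
  · exact zero_pow Fintype.card_ne_zero

theorem frobSeries_injective : Function.Injective (frobSeries Fq K) := fun f g h => by
  ext n
  have := congrArg (PowerSeries.coeff n) h
  rw [coeff_frobSeries, coeff_frobSeries] at this
  exact (FiniteField.frobeniusAlgHom Fq K).toRingHom.injective this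

end FrobeniusRules

section Elimination

variable {Fq K : Type*} [Field Fq] [Fintype Fq] [Field K] [Algebra Fq K]

/-- The two equations for the coordinates `b, d` of a `τ`-invariant vector along `τ e₁, τ e₂`
are equivalent to a single equation for `b`. -/
theorem recOp_eq_zero_iff_of_frobSeries_eq {t a12 a21 ε δ : K} (ha : a21 ≠ 0)
    (hδ : δ * a21 ^ Fintype.card Fq ^ 2 = a21)
    (h12 : t ^ Fintype.card Fq + δ * t ^ Fintype.card Fq ^ 2 - a21 * a12 ^ Fintype.card Fq = 0)
    {b d : K⟦X⟧}
    (h : b = frobSeries Fq K ((PowerSeries.X - PowerSeries.C t) * frobSeries Fq K b) -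
      PowerSeries.C a21 * frobSeries Fq K d) :
    d = frobSeries Fq K ((PowerSeries.X - PowerSeries.C t) * frobSeries Fq K d -
      PowerSeries.C ε * frobSeries Fq K b) - PowerSeries.C a12 * frobSeries Fq K b ↔
    recOp Fq (t ^ Fintype.card Fq ^ 3 * t ^ Fintype.card Fq ^ 2 * δ)
      (ε ^ Fintype.card Fq ^ 2 * a21) (1 + δ)
      ((t ^ Fintype.card Fq ^ 3 + t ^ Fintype.card Fq ^ 2) * δ) δ b = 0 := by
  have e2 (x : K) : (x ^ Fintype.card Fq) ^ Fintype.card Fq = x ^ Fintype.card Fq ^ 2 := by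
    rw [← pow_mul, pow_two]
  have e3 : (t ^ Fintype.card Fq ^ 2) ^ Fintype.card Fq = t ^ Fintype.card Fq ^ 3 := by
    rw [← pow_mul, ← pow_succ]
  -- After a twist and multiplication by a₂₁, d occurs only as a₂₁d⁽¹⁾ and a₂₁d⁽³⁾, which `h` and
  -- its second twist express through b.
  rw [← frobSeries_injective.eq_iff (f := frobSeries Fq K), ← sub_eq_zero,
    ← mul_right_inj' (a := PowerSeries.C a21) (by simpa using ha), mul_zero]
  have h1 := congrArg (frobSeries Fq K) (congrArg (frobSeries Fq K) h)
  rw [recOp_apply]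
  have p2 (f : K⟦X⟧) : (frobSeries Fq K ^ 2) f = frobSeries Fq K (frobSeries Fq K f) := rfl
  have p3 (f : K⟦X⟧) : (frobSeries Fq K ^ 3) f =
    frobSeries Fq K (frobSeries Fq K (frobSeries Fq K f)) := rfl
  have p4 (f : K⟦X⟧) : (frobSeries Fq K ^ 4) f =
    frobSeries Fq K (frobSeries Fq K (frobSeries Fq K (frobSeries Fq K f))) := rfl
  simp only [p2, p3, p4]
  simp only [map_sub, frobSeries_mul, frobSeries_X, frobSeries_C, e2, e3] at h h1 ⊢
  have hδ' := congrArg (PowerSeries.C (R := K)) hδ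
  have h12' := congrArg (PowerSeries.C (R := K)) h12
  simp only [map_add, map_mul, map_sub, map_one, map_zero] at hδ' h12' ⊢
  rw [← neg_eq_zero, iff_iff_eq]
  congr 1
  -- `h` removes d⁽¹⁾, `hδ'` and `h1` remove d⁽³⁾, and `h12'` cancels the term of degree 0 in T
  -- multiplying b⁽²⁾.
  linear_combination -h - (PowerSeries.X - PowerSeries.C (t ^ Fintype.card Fq ^ 2)) *
      frobSeries Fq K (frobSeries Fq K (frobSeries Fq K d)) * hδ' +
    PowerSeries.C δ * (PowerSeries.X - PowerSeries.C (t ^ Fintype.card Fq ^ 2)) * h1 +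
    frobSeries Fq K (frobSeries Fq K b) * h12'

end Elimination

/-! ### H¹ as a module of solutions -/

section Invariants

variable {Fq : Type*} [Field Fq] [Fintype Fq]

/-- The q-th roots of a null sequence again form a null sequence. -/
theorem exists_frobTate_eq (s : TateAlg Fq) : ∃ r, frobTate Fq r = s := by
  choose g hg using frob_surjective Fq
  have hq : (Fintype.card Fq : ℝ) ≠ 0 := by exact_mod_cast Fintype.card_ne_zero
  refine ⟨⟨PowerSeries.mk fun i => g (PowerSeries.coeff i s.1), ?_⟩, ?_⟩
  · have hs : Filter.Tendsto (fun i => PowerSeries.coeff i s.1) Filter.atTop (𝓝 0) := s.2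
    have hroot := (tendsto_zero_iff_norm_tendsto_zero.1 hs).rpow_const
      (p := (Fintype.card Fq : ℝ)⁻¹) (Or.inr (by positivity))
    rw [Real.zero_rpow (inv_ne_zero hq)] at hroot
    refine tendsto_zero_iff_norm_tendsto_zero.2 (hroot.congr fun i => ?_)
    rw [PowerSeries.coeff_mk]
    conv_lhs => rw [← hg (PowerSeries.coeff i s.1), frob_apply, norm_pow]
    exact Real.pow_rpow_inv_natCast (norm_nonneg _) Fintype.card_ne_zero
  · ext i
    change PowerSeries.coeff i (PowerSeries.map (frob Fq)
      (PowerSeries.mk fun i => g (PowerSeries.coeff i s.1))) = PowerSeries.coeff i s.1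
    rw [PowerSeries.coeff_map, PowerSeries.coeff_mk, hg]

theorem coe_frobTate (s : TateAlg Fq) :
    (frobTate Fq s : (CInfty Fq)⟦X⟧) = frobSeries Fq (CInfty Fq) s := rfl

theorem coe_C_smul_tate (c : CInfty Fq) (s : TateAlg Fq) :
    ((Polynomial.C c • s : TateAlg Fq) : (CInfty Fq)⟦X⟧) = PowerSeries.C c * s := by
  rw [Subalgebra.coe_smul, Algebra.smul_def, PowerSeries.algebraMap_apply']
  simp

theorem coe_X_sub_C_smul_tate (c : CInfty Fq) (s : TateAlg Fq) :
    (((Polynomial.X - Polynomial.C c : (CInfty Fq)[X]) • s : TateAlg Fq) : (CInfty Fq)⟦X⟧) =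
      (PowerSeries.X - PowerSeries.C c) * (s : (CInfty Fq)⟦X⟧) := by
  rw [Subalgebra.coe_smul, Algebra.smul_def, PowerSeries.algebraMap_apply']
  simp

variable (a12 a21 ε : CInfty Fq)

/-- `M(A, N_ε)` for `A` with zero diagonal and `N_ε = ε E₁₂`. -/
abbrev antidiagTau := tauAN (Fq := Fq) !![0, a12; a21, 0] (ε • !![0, 1; 0, 0])

/-- The coordinates on `M(A, N_ε) ⊗ ℂ_∞{T}`. -/
abbrev antidiagCoord := tensorCoord (Fq := Fq) !![0, a12; a21, 0] (ε • !![0, 1; 0, 0])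

variable {a12 a21 ε}

theorem tauTensor_eq_iff
    (x : MotiveAN (Fq := Fq) !![0, a12; a21, 0] (ε • !![0, 1; 0, 0]) ⊗[(CInfty Fq)[X]]
      TateAlg Fq) :
    tauTensor (antidiagTau a12 a21 ε) x = x ↔
      antidiagCoord a12 a21 ε x (Sum.inl 0) = (Polynomial.X - Polynomial.C (theta Fq)) •
        frobTate Fq (antidiagCoord a12 a21 ε x (Sum.inr 0)) ∧
      antidiagCoord a12 a21 ε x (Sum.inl 1) = (Polynomial.X - Polynomial.C (theta Fq)) •
        frobTate Fq (antidiagCoord a12 a21 ε x (Sum.inr 1)) -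
          Polynomial.C ε • frobTate Fq (antidiagCoord a12 a21 ε x (Sum.inr 0)) ∧
      antidiagCoord a12 a21 ε x (Sum.inr 0) =
        frobTate Fq (antidiagCoord a12 a21 ε x (Sum.inl 0)) -
          Polynomial.C a21 • frobTate Fq (antidiagCoord a12 a21 ε x (Sum.inr 1)) ∧
      antidiagCoord a12 a21 ε x (Sum.inr 1) =
        frobTate Fq (antidiagCoord a12 a21 ε x (Sum.inl 1)) -
          Polynomial.C a12 • frobTate Fq (antidiagCoord a12 a21 ε x (Sum.inr 0)) := by
  rw [← (antidiagCoord a12 a21 ε).injective.eq_iff, Finsupp.ext_iff, Sum.forall]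
  have h := tensorCoord_tauTensor !![0, a12; a21, 0] (ε • !![0, 1; 0, 0]) x
  simp only [Fin.forall_fin_two, (h _).1, (h _).2, Fin.sum_univ_two]
  simp only [Matrix.smul_apply, Matrix.of_apply, Matrix.cons_val', Matrix.cons_val_zero,
    Matrix.cons_val_one, Matrix.cons_val_fin_one, smul_eq_mul, mul_zero, mul_one, map_zero,
    zero_smul, add_zero, zero_add, sub_zero]
  constructor
  · rintro ⟨⟨h1, h2⟩, h3, h4⟩
    exact ⟨h1.symm, h2.symm, h3.symm, h4.symm⟩
  · rintro ⟨h1, h2, h3, h4⟩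
    exact ⟨⟨h1.symm, h2.symm⟩, h3.symm, h4.symm⟩

end Invariants

section HOneEquiv

variable {Fq : Type*} [Field Fq] [Fintype Fq] (a12 a21 ε : CInfty Fq)

/-- The solutions of the recursion for the coordinate along `τ e₁` of a `τ`-invariant vector. -/
def invariantCoeffs : Submodule Fq[X] (CInfty Fq)⟦X⟧ :=
  restrictedSol Fq
    (theta Fq ^ Fintype.card Fq ^ 3 * theta Fq ^ Fintype.card Fq ^ 2 *
      (a21 / a21 ^ Fintype.card Fq ^ 2))
    (ε ^ Fintype.card Fq ^ 2 * a21) (1 + a21 / a21 ^ Fintype.card Fq ^ 2)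
    ((theta Fq ^ Fintype.card Fq ^ 3 + theta Fq ^ Fintype.card Fq ^ 2) *
      (a21 / a21 ^ Fintype.card Fq ^ 2)) (a21 / a21 ^ Fintype.card Fq ^ 2)

variable {a12 a21 ε} (ha : a21 ≠ 0)
  (h12 : theta Fq ^ Fintype.card Fq / a21 +
    theta Fq ^ (Fintype.card Fq ^ 2) / a21 ^ (Fintype.card Fq ^ 2) - a12 ^ Fintype.card Fq = 0)

include ha h12 in
theorem mem_invariantCoeffs_iff {b d : TateAlg Fq}
    (h : (b : (CInfty Fq)⟦X⟧) = frobSeries Fq (CInfty Fq)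
      ((PowerSeries.X - PowerSeries.C (theta Fq)) * frobSeries Fq (CInfty Fq) b) -
        PowerSeries.C a21 * frobSeries Fq (CInfty Fq) d) :
    (d : (CInfty Fq)⟦X⟧) = frobSeries Fq (CInfty Fq)
      ((PowerSeries.X - PowerSeries.C (theta Fq)) * frobSeries Fq (CInfty Fq) d -
        PowerSeries.C ε * frobSeries Fq (CInfty Fq) b) -
          PowerSeries.C a12 * frobSeries Fq (CInfty Fq) b ↔
      (b : (CInfty Fq)⟦X⟧) ∈ invariantCoeffs a21 ε := by
  have h12' : theta Fq ^ Fintype.card Fq + a21 / a21 ^ Fintype.card Fq ^ 2 *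
      theta Fq ^ Fintype.card Fq ^ 2 - a21 * a12 ^ Fintype.card Fq = 0 := by
    have := congrArg (a21 * ·) h12
    simp only [mul_zero] at this
    rw [← this]
    field_simp
  rw [recOp_eq_zero_iff_of_frobSeries_eq ha (div_mul_cancel₀ _ (pow_ne_zero _ ha)) h12' h,
    invariantCoeffs, mem_restrictedSol]
  exact (and_iff_left b.2).symm

theorem coe_polynomial_smul_tate (p : Fq[X]) (s : TateAlg Fq) :
    ((p.map (algebraMap Fq (CInfty Fq)) • s : TateAlg Fq) : (CInfty Fq)⟦X⟧) =
      p • (s : (CInfty Fq)⟦X⟧) := by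
  rw [Subalgebra.coe_smul, Algebra.smul_def, Algebra.smul_def, PowerSeries.algebraMap_apply',
    PowerSeries.algebraMap_apply']
  congr 1
  ext i
  simp

theorem mem_HOne_antidiagTau
    {x : MotiveAN (Fq := Fq) !![0, a12; a21, 0] (ε • !![0, 1; 0, 0]) ⊗[(CInfty Fq)[X]]
      TateAlg Fq} :
    x ∈ HOne (antidiagTau a12 a21 ε) ↔ tauTensor (antidiagTau a12 a21 ε) x = x := Iff.rfl

/-- The equations for the coordinates along `τ e₁, τ e₂` of a `τ`-invariant vector. -/
theorem coord_eq_of_mem_HOne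
    {x : MotiveAN (Fq := Fq) !![0, a12; a21, 0] (ε • !![0, 1; 0, 0]) ⊗[(CInfty Fq)[X]]
      TateAlg Fq} (hx : x ∈ HOne (antidiagTau a12 a21 ε)) :
    (antidiagCoord a12 a21 ε x (Sum.inr 0) : (CInfty Fq)⟦X⟧) = frobSeries Fq (CInfty Fq)
      ((PowerSeries.X - PowerSeries.C (theta Fq)) *
        frobSeries Fq (CInfty Fq) (antidiagCoord a12 a21 ε x (Sum.inr 0))) -
        PowerSeries.C a21 * frobSeries Fq (CInfty Fq) (antidiagCoord a12 a21 ε x (Sum.inr 1)) ∧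
    (antidiagCoord a12 a21 ε x (Sum.inr 1) : (CInfty Fq)⟦X⟧) = frobSeries Fq (CInfty Fq)
      ((PowerSeries.X - PowerSeries.C (theta Fq)) *
        frobSeries Fq (CInfty Fq) (antidiagCoord a12 a21 ε x (Sum.inr 1)) -
        PowerSeries.C ε * frobSeries Fq (CInfty Fq) (antidiagCoord a12 a21 ε x (Sum.inr 0))) -
      PowerSeries.C a12 * frobSeries Fq (CInfty Fq) (antidiagCoord a12 a21 ε x (Sum.inr 0)) := by
  obtain ⟨h1, h2, h3, h4⟩ := (tauTensor_eq_iff x).1 (mem_HOne_antidiagTau.1 hx)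
  rw [h1] at h3
  rw [h2] at h4
  have h3' := congrArg (Subtype.val) h3
  have h4' := congrArg (Subtype.val) h4
  simp only [AddSubgroupClass.coe_sub, coe_frobTate, coe_C_smul_tate, coe_X_sub_C_smul_tate]
    at h3' h4'
  exact ⟨h3', h4'⟩

/-- The coordinate along `τ e₁`, as an `𝔽_q[T]`-linear map. -/
def tauCoord (a12 a21 ε : CInfty Fq) :
    MotiveAN (Fq := Fq) !![0, a12; a21, 0] (ε • !![0, 1; 0, 0]) ⊗[(CInfty Fq)[X]] TateAlg Fq
      →ₗ[Fq[X]] (CInfty Fq)⟦X⟧ where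
  toFun x := antidiagCoord a12 a21 ε x (Sum.inr 0)
  map_add' x y := by
    rw [map_add, Finsupp.add_apply, Subalgebra.coe_add]
  map_smul' p x := by
    have h : p • x = p.map (algebraMap Fq (CInfty Fq)) • x := rfl
    rw [h, map_smul, Finsupp.smul_apply]
    exact coe_polynomial_smul_tate p _

/-- The coordinate along `τ e₁` of a `τ`-invariant vector of `M(A, N_ε) ⊗ ℂ_∞{T}`. -/
def hOneCoeff : HOne (antidiagTau a12 a21 ε) →ₗ[Fq[X]] invariantCoeffs a21 ε :=
  ((tauCoord a12 a21 ε).comp (HOne (antidiagTau a12 a21 ε)).subtype).codRestrict _ fun x =>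
    (mem_invariantCoeffs_iff ha h12 (coord_eq_of_mem_HOne x.2).1).1 (coord_eq_of_mem_HOne x.2).2

theorem frobTate_injective : Function.Injective (frobTate Fq) := fun _ _ h =>
  Subtype.ext (frobSeries_injective (Fq := Fq) (congrArg Subtype.val h))

/-- The coordinate b determines a, then d⁽¹⁾ because a₂₁ ≠ 0, hence d, and finally c. -/
theorem hOneCoeff_injective : Function.Injective (hOneCoeff (a12 := a12) (ε := ε) ha h12) := by
  intro x y hxy
  have hb : antidiagCoord a12 a21 ε x (Sum.inr 0) = antidiagCoord a12 a21 ε y (Sum.inr 0) :=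
    Subtype.ext (congrArg (fun z : invariantCoeffs a21 ε => (z : (CInfty Fq)⟦X⟧)) hxy)
  obtain ⟨h1, h2, h3, -⟩ := (tauTensor_eq_iff x.1).1 (mem_HOne_antidiagTau.1 x.2)
  obtain ⟨k1, k2, k3, -⟩ := (tauTensor_eq_iff y.1).1 (mem_HOne_antidiagTau.1 y.2)
  rw [hb] at h1 h2 h3
  have ha1 := h1.trans k1.symm
  have hd : antidiagCoord a12 a21 ε x (Sum.inr 1) = antidiagCoord a12 a21 ε y (Sum.inr 1) := by
    apply frobTate_injective
    have h := h3.symm.trans k3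
    rw [ha1, sub_right_inj] at h
    have h' := congrArg Subtype.val h
    rw [coe_C_smul_tate, coe_C_smul_tate] at h'
    exact Subtype.ext (mul_left_cancel₀ (by simpa using ha) h')
  rw [hd] at h2
  refine Subtype.ext ((antidiagCoord a12 a21 ε).injective ?_)
  ext1 k
  rcases k with k | k <;> fin_cases k
  exacts [ha1, h2.trans k2.symm, hb, hd]

/-- The third invariance equation prescribes d⁽¹⁾, and d exists in `ℂ_∞{T}` because Frobenius is
surjective there. The recursion for b then yields the fourth equation. -/
theorem hOneCoeff_surjective : Function.Surjective (hOneCoeff (a12 := a12) (ε := ε) ha h12) := by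
  rintro ⟨f, hf⟩
  let b : TateAlg Fq := ⟨f, hf.2⟩
  let a : TateAlg Fq := (Polynomial.X - Polynomial.C (theta Fq)) • frobTate Fq b
  obtain ⟨d, hd⟩ := exists_frobTate_eq (Polynomial.C a21⁻¹ • (frobTate Fq a - b))
  let c : TateAlg Fq := (Polynomial.X - Polynomial.C (theta Fq)) • frobTate Fq d -
    Polynomial.C ε • frobTate Fq b
  have hbd : b = frobTate Fq a - Polynomial.C a21 • frobTate Fq d := by
    rw [hd, ← mul_smul, ← Polynomial.C_mul, mul_inv_cancel₀ ha, Polynomial.C_1, one_smul,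
      sub_sub_cancel]
  have hbd' := congrArg Subtype.val hbd
  have hdc : d = frobTate Fq c - Polynomial.C a12 • frobTate Fq b := by
    apply Subtype.ext
    simp only [a, c, AddSubgroupClass.coe_sub, coe_frobTate, coe_C_smul_tate,
      coe_X_sub_C_smul_tate] at hbd' ⊢
    exact (mem_invariantCoeffs_iff (b := b) (d := d) ha h12 hbd').2 hf
  let g : Fin 2 ⊕ Fin 2 →₀ TateAlg Fq :=
    Finsupp.equivFunOnFinite.symm (Sum.elim ![a, c] ![b, d])
  refine ⟨⟨(antidiagCoord a12 a21 ε).symm g, ?_⟩, ?_⟩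
  · rw [mem_HOne_antidiagTau, tauTensor_eq_iff, LinearEquiv.apply_symm_apply]
    exact ⟨rfl, rfl, hbd, hdc⟩
  · apply Subtype.ext
    change (antidiagCoord a12 a21 ε ((antidiagCoord a12 a21 ε).symm g) (Sum.inr 0) :
      (CInfty Fq)⟦X⟧) = f
    rw [LinearEquiv.apply_symm_apply]
    rfl

/-- `H¹(M(A, N_ε))` is isomorphic to the module of solutions of the recursion. -/
def hOneEquiv : HOne (antidiagTau a12 a21 ε) ≃ₗ[Fq[X]] invariantCoeffs a21 ε :=
  LinearEquiv.ofBijective _ ⟨hOneCoeff_injective ha h12, hOneCoeff_surjective ha h12⟩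

end HOneEquiv

/-! ### Absolute values of the parameters -/

section Norms

variable {Fq : Type*} [Field Fq] [Fintype Fq] {a21 : CInfty Fq}
  (h21 : ordInfty a21 =
      ((-((Fintype.card Fq : ℝ) ^ 2 / ((Fintype.card Fq : ℝ) - 1)) : ℝ) : WithTop ℝ))

include h21

theorem ne_zero_of_ordInfty_eq : a21 ≠ 0 := by
  rintro rfl
  rw [ordInfty, if_pos rfl] at h21
  exact WithTop.top_ne_coe h21

theorem norm_pow_of_ordInfty_eq {k : ℕ} (hk : Fintype.card Fq = k + 1) (hk0 : k ≠ 0) :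
    ‖a21‖ ^ k = (Fintype.card Fq : ℝ) ^ (k + 1) ^ 2 := by
  have ha := ne_zero_of_ordInfty_eq h21
  have hq : (1 : ℝ) < Fintype.card Fq := by exact_mod_cast Fintype.one_lt_card
  rw [ordInfty, if_neg ha, WithTop.coe_inj, neg_inj] at h21
  have hk0' : (k : ℝ) ≠ 0 := by exact_mod_cast hk0
  have he : (Fintype.card Fq : ℝ) ^ 2 / ((Fintype.card Fq : ℝ) - 1) * k =
      (((k + 1) ^ 2 : ℕ) : ℝ) := by
    rw [hk]
    push_cast
    rw [add_sub_cancel_right]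
    field_simp
  rw [← Real.rpow_logb (by linarith) hq.ne' (norm_pos_iff.2 ha), h21,
    ← Real.rpow_mul_natCast (by linarith), he, Real.rpow_natCast]

theorem one_le_norm_of_ordInfty_eq : 1 ≤ ‖a21‖ := by
  obtain ⟨k, hk⟩ := Nat.exists_eq_add_of_lt (Fintype.one_lt_card (α := Fq))
  have h := norm_pow_of_ordInfty_eq h21 (k := k + 1) (by omega) (by omega)
  by_contra! hlt
  have h1 := pow_lt_one₀ (norm_nonneg a21) hlt (Nat.succ_ne_zero k)
  rw [h] at h1
  have hq : (1 : ℝ) ≤ Fintype.card Fq := by exact_mod_cast Fintype.card_pos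
  exact absurd h1 (not_lt.2 (one_le_pow₀ hq))

theorem norm_div_pow_of_ordInfty_eq : ‖a21 / a21 ^ Fintype.card Fq ^ 2‖ =
    ((Fintype.card Fq : ℝ) ^ (Fintype.card Fq ^ 3 + Fintype.card Fq ^ 2))⁻¹ := by
  obtain ⟨k, hk⟩ := Nat.exists_eq_add_of_lt (Fintype.one_lt_card (α := Fq))
  have h := norm_pow_of_ordInfty_eq h21 (k := k + 1) (by omega) (by omega)
  have ha := norm_pos_iff.2 (ne_zero_of_ordInfty_eq h21)
  -- This is q² - 1 = (q-1)(q+1) with q-1 = k+1, so the known power |a₂₁|^(q-1) determines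
  -- |a₂₁|^(q²-1).
  have hexp : Fintype.card Fq ^ 2 = (k + 1) * (k + 3) + 1 := by rw [hk]; ring
  have hpow : ‖a21‖ ^ Fintype.card Fq ^ 2 =
      (Fintype.card Fq : ℝ) ^ (Fintype.card Fq ^ 3 + Fintype.card Fq ^ 2) * ‖a21‖ := by
    rw [hexp, pow_succ, pow_mul, h, ← pow_mul, ← hexp]
    congr 2
    rw [hk]
    ring
  rw [norm_div, norm_pow, hpow]
  field_simp

end Norms

/-! ### The cases ε = 0 and ε = 1 -/

section Main

variable {Fq : Type*} [Field Fq] [Fintype Fq] {a12 a21 : CInfty Fq}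
  (h21 : ordInfty a21 =
      ((-((Fintype.card Fq : ℝ) ^ 2 / ((Fintype.card Fq : ℝ) - 1)) : ℝ) : WithTop ℝ))

include h21

/-- The prescribed ord a₂₁ makes |δ| = q^(-(q³+q²)), which cancels the powers of θ exactly. -/
theorem norm_alpha : ‖theta Fq ^ Fintype.card Fq ^ 3 * theta Fq ^ Fintype.card Fq ^ 2 *
    (a21 / a21 ^ Fintype.card Fq ^ 2)‖ = 1 := by
  rw [norm_mul, norm_div_pow_of_ordInfty_eq h21, ← pow_add, norm_pow, norm_theta]
  exact mul_inv_cancel₀ (pow_ne_zero _ (by exact_mod_cast Fintype.card_ne_zero))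

theorem norm_delta_lt_one : ‖a21 / a21 ^ Fintype.card Fq ^ 2‖ < 1 := by
  rw [norm_div_pow_of_ordInfty_eq h21]
  refine inv_lt_one_of_one_lt₀ (one_lt_pow₀ (by exact_mod_cast Fintype.one_lt_card) ?_)
  have : 0 < Fintype.card Fq := Fintype.card_pos
  positivity

theorem norm_beta : ‖1 + a21 / a21 ^ Fintype.card Fq ^ 2‖ = 1 := by
  have h := norm_delta_lt_one h21
  rw [IsUltrametricDist.norm_add_eq_max_of_norm_ne_norm (by rw [norm_one]; exact h.ne'), norm_one,
    max_eq_left h.le]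

theorem norm_gamma_le : ‖(theta Fq ^ Fintype.card Fq ^ 3 + theta Fq ^ Fintype.card Fq ^ 2) *
    (a21 / a21 ^ Fintype.card Fq ^ 2)‖ ≤ ((Fintype.card Fq : ℝ) ^ Fintype.card Fq ^ 2)⁻¹ := by
  have hq : (1 : ℝ) ≤ Fintype.card Fq := by exact_mod_cast Fintype.card_pos
  have hsum : ‖theta Fq ^ Fintype.card Fq ^ 3 + theta Fq ^ Fintype.card Fq ^ 2‖ ≤
      (Fintype.card Fq : ℝ) ^ Fintype.card Fq ^ 3 := by
    refine (IsUltrametricDist.norm_add_le_max _ _).trans ?_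
    rw [norm_pow, norm_pow, norm_theta]
    exact max_le le_rfl (pow_le_pow_right₀ hq (Nat.pow_le_pow_right Fintype.card_pos (by norm_num)))
  have hpos : (0 : ℝ) < (Fintype.card Fq : ℝ) ^ Fintype.card Fq ^ 3 := by positivity
  rw [norm_mul, norm_div_pow_of_ordInfty_eq h21, pow_add, mul_inv, ← mul_assoc]
  refine mul_le_of_le_one_left (by positivity) ?_
  rw [← div_eq_mul_inv]
  exact (div_le_one hpos).2 hsum

theorem norm_gamma_lt_one : ‖(theta Fq ^ Fintype.card Fq ^ 3 + theta Fq ^ Fintype.card Fq ^ 2) *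
    (a21 / a21 ^ Fintype.card Fq ^ 2)‖ < 1 := by
  refine (norm_gamma_le h21).trans_lt
    (inv_lt_one_of_one_lt₀ (one_lt_pow₀ (by exact_mod_cast Fintype.one_lt_card) ?_))
  have : 0 < Fintype.card Fq := Fintype.card_pos
  positivity

theorem invariantCoeffs_zero_eq_bot : invariantCoeffs a21 0 = ⊥ := by
  have hq : Fintype.card Fq ^ 2 ≠ 0 := pow_ne_zero 2 Fintype.card_ne_zero
  rw [invariantCoeffs, zero_pow hq, zero_mul]
  exact restrictedSol_eq_bot (norm_alpha h21) (norm_beta h21) (norm_gamma_lt_one h21)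
    (norm_delta_lt_one h21)

theorem finrank_invariantCoeffs_one (hq : 2 < Fintype.card Fq) :
    Module.finrank Fq[X] (invariantCoeffs a21 1) = 4 := by
  have hα := norm_alpha h21
  have h1 := one_le_norm_of_ordInfty_eq h21
  have : NeZero (theta Fq ^ Fintype.card Fq ^ 3 * theta Fq ^ Fintype.card Fq ^ 2 *
    (a21 / a21 ^ Fintype.card Fq ^ 2)) := ⟨norm_ne_zero_iff.1 (by rw [hα]; exact one_ne_zero)⟩
  rw [invariantCoeffs, one_pow, one_mul]
  refine finrank_restrictedSol h1 (norm_beta h21).le (norm_gamma_lt_one h21).le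
    (norm_delta_lt_one h21).le fun v hv => ?_
  obtain ⟨k, hk⟩ := Nat.exists_eq_add_of_lt (Fintype.one_lt_card (α := Fq))
  have hk' : Fintype.card Fq = (k + 1) + 1 := by omega
  have hQ : (1 : ℝ) < Fintype.card Fq := by exact_mod_cast Fintype.one_lt_card
  -- Since |α| = 1, the leading term of the kernel equation is bounded by the larger of the other
  -- two.
  have hu : ‖v‖ ^ Fintype.card Fq ^ 4 ≤ max (‖a21‖ * ‖v‖ ^ Fintype.card Fq ^ 3) ‖v‖ := by
    rw [addPoly_apply, sub_add, sub_eq_zero] at hv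
    replace hv := congrArg norm hv
    rw [norm_mul, hα, one_mul, norm_pow] at hv
    rw [hv, ← norm_pow, ← norm_mul, sub_eq_add_neg, ← norm_neg v]
    exact IsUltrametricDist.norm_add_le_max _ _
  have hslope := lt_of_newton_slope (k := k + 1) (by omega) hQ h1
    (norm_pow_of_ordInfty_eq h21 hk' (Nat.succ_ne_zero k)) (norm_nonneg v) (by rwa [← hk'])
  rw [← hk'] at hslope
  have hpos (e : ℕ) : (0 : ℝ) < (Fintype.card Fq : ℝ) ^ e := by positivity
  refine ⟨?_, ?_, ?_⟩
  · rw [norm_mul, norm_beta h21, one_mul, norm_pow]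
    exact hslope.1
  · rw [norm_mul, norm_pow]
    refine (mul_le_mul_of_nonneg_right (norm_gamma_le h21) (by positivity)).trans_lt ?_
    rw [inv_mul_lt_iff₀ (hpos _), mul_comm]
    exact hslope.2.1
  · rw [norm_mul, norm_pow, norm_div_pow_of_ordInfty_eq h21, inv_mul_lt_iff₀ (hpos _), mul_one]
    exact hslope.2.2

end Main

end

theorem theorem5p1 {Fq : Type*} [Field Fq] [Fintype Fq] (hq : 2 < Fintype.card Fq)
    (a12 a21 : CInfty Fq)
    (h21 : ordInfty a21 =
      ((-((Fintype.card Fq : ℝ) ^ 2 / ((Fintype.card Fq : ℝ) - 1)) : ℝ) : WithTop ℝ))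
    (h12 : theta Fq ^ Fintype.card Fq / a21 +
      theta Fq ^ (Fintype.card Fq ^ 2) / a21 ^ (Fintype.card Fq ^ 2) -
      a12 ^ Fintype.card Fq = 0) :
    let A : Matrix (Fin 2) (Fin 2) (CInfty Fq) := !![0, a12; a21, 0]
    let N : CInfty Fq → Matrix (Fin 2) (Fin 2) (CInfty Fq) := fun ε => ε • !![0, 1; 0, 0]
    (∀ ε : CInfty Fq, ε = 0 ∨ ε = 1 →
      IsTMotive (tauAN A (N ε)) ∧ HasDimension (tauAN A (N ε)) 2 ∧
        Module.finrank (CInfty Fq)[X] (MotiveAN A (N ε)) = 4) ∧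
    (HOne (tauAN A (N 0)) = ⊥ ∧ ¬ IsUniformizable (tauAN A (N 0))) ∧
    (hOne (tauAN A (N 1)) = 4 ∧ IsUniformizable (tauAN A (N 1))) := by
  intro A N
  have ha := ne_zero_of_ordInfty_eq h21
  have hN (ε : CInfty Fq) : N ε ^ 2 = 0 := by
    ext i j
    fin_cases i <;> fin_cases j <;> simp [N, pow_two, Matrix.mul_apply]
  have hrank (ε : CInfty Fq) : Module.finrank (CInfty Fq)[X] (MotiveAN A (N ε)) = 4 :=
    finrank_motiveAN A (N ε)
  have h0 : HOne (tauAN A (N 0)) = ⊥ := by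
    have hzero : (0 : MotiveAN A (N 0) ⊗[(CInfty Fq)[X]] TateAlg Fq) ∈ HOne (tauAN A (N 0)) :=
      (HOne (tauAN A (N 0))).zero_mem
    have hsub : Subsingleton (invariantCoeffs a21 (0 : CInfty Fq)) := by
      rw [invariantCoeffs_zero_eq_bot h21]
      infer_instance
    rw [Submodule.eq_bot_iff]
    intro x hx
    exact congrArg Subtype.val ((hOneEquiv (a12 := a12) (ε := 0) ha h12).injective
      (Subsingleton.elim (hOneEquiv ha h12 ⟨x, hx⟩) (hOneEquiv ha h12 ⟨0, hzero⟩)))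
  have h1 : hOne (tauAN A (N 1)) = 4 :=
    (hOneEquiv (a12 := a12) (ε := 1) ha h12).finrank_eq.trans (finrank_invariantCoeffs_one h21 hq)
  refine ⟨fun ε _ => ⟨isTMotive_tauAN A (N ε) (hN ε), hasDimension_tauAN A (N ε), hrank ε⟩,
    ⟨h0, ?_⟩, h1, h1.trans (hrank 1).symm⟩
  rw [IsUniformizable, hrank, hOne, h0, finrank_bot]
  norm_num
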